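/- Let $\mathbb F$ be $\mathbb R$ or $\mathbb C$. A \emph{basis} of a Banach space $\mathbb X$ over $\mathbb F$ is a norm-bounded sequence $(x_n)_{n\ge1}$ with dense linear span for which there is a (unique) norm-bounded sequence $(x_n^*)_{n\ge 1}$ in $\mathbb X^*$, the dual basis, with $x_n^*(x_k)=\delta_{n,k}$. For finite $A\subset\mathbb N$ put $S_A(f)=\sum_{n\in A}x_n^*(f)\,x_n$. The basis is \emph{unconditional} if $\sup_A\|S_A\|<\infty$, and \emph{conditional} otherwise; it is \emph{quasi-greedy} if there is a constant $C$ such that $\|S_A(f)\|\le C\|f\|$ whenever $f\in\mathbb X$ and $A$ is a finite set with $|x_n^*(f)|\ge|x_k^*(f)|$ for all $n\in A$, $k\notin A$. Its fundamental function is $\varphi(m)=\sup_{|A|\le m}\|\sum_{k\in A}x_k\|$; if $\varphi^*(m)=\sup_{|A|\le m}\|\sum_{k\in A}x_k^*\|$, the basis is \emph{bidemocratic} if $\varphi(m)\varphi^*(m)\le \Delta\, m$ for some constant $\Delta$ and all $m\ge1$. For a weight $v=(v_n)_{n\ge1}$ (with $v_n\ge 0$, $v_1>0$), let $d_{1,1}(v)$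 be the space of all $f\in c_0$ whose non-increasing rearrangement $(a_n)$ satisfies $\sum_n a_nv_n<\infty$, let $m(v)$ be the space of all $f\in c_0$ with $\|f\|_{m(v)}=\sup_m\big(\sum_{n\le m}a_n\big)/\big(\sum_{n\le m}v_n\big)<\infty$, and let $m_0(v)$ be the closure in $m(v)$ of the finitely supported sequences. \textbf{Theorem.} Let $(s_m)_{m\ge1}$ be a non-decreasing unbounded sequence of positive scalars such that $(m/s_m)_{m\ge1}$ is non-decreasing and unbounded. Then there is a Banach space with a conditional bidemocratic quasi-greedy basis whose fundamental function satisfies $\varphi(m)\approx s_m$, i.e. $c\,s_m\le\varphi(m)\le C\,s_m$ for some constants $c,C>0$ and all $m\ge1$. More precisely, let $w$ and $w^*$ be the weights with $\sum_{n\le m}w_n=s_m$ and $\sum_{n\le m}w^*_n=m/s_m$ for all $m\ge1$. Then $d_{1,1}(w)$ is a Banach space under a norm equivalent to $\sum_n a_nw_n$, $m_0(w^*)$ is a Banach space under $\|\cdot\|_{m(w^*)}$, the unit vectors $(x_n)$ and $(y_n)$ are bases of them, and the sequence in $d_{1,1}(w)\oplus m_0(w^*)$ (with the maximum norm) given by \[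 z_{2n-1}=\tfrac1{\sqrt2}(x_n,y_n),\qquad z_{2n}=\tfrac1{\sqrt2}(x_n,-y_n),\qquad n\ge1, \] is a basis with these properties. -/

import Mathlib

open Filter Topology
open scoped ENNReal

universe u

noncomputable section

namespace GreedyBasis

/-! ### Bases

Sequences indexed in the literature by `n = 1, 2, 3, …` are indexed here by `n = 0, 1, 2, …`. -/

section Bases

variable {𝕜 : Type*} [RCLike 𝕜] {E : Type*} [NormedAddCommGroup E] [NormedSpace 𝕜 E]

/-- The norm-bounded sequence `x` generates `E`, and `x'` is a norm-bounded sequence in the dual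
space that is biorthogonal to `x`; that is, `x` is a basis of `E` with dual basis `x'`. (By the
density of the span, `x'` is determined by `x`.) -/
structure IsBasis (x : ℕ → E) (x' : ℕ → StrongDual 𝕜 E) : Prop where
  bounded : ∃ C : ℝ, ∀ n, ‖x n‖ ≤ C
  bounded_dual : ∃ C : ℝ, ∀ n, ‖x' n‖ ≤ C
  dense_span : Dense (Submodule.span 𝕜 (Set.range x) : Set E)
  biorthogonal : ∀ n k, x' n (x k) = if n = k then 1 else 0

/-- The fundamental function `φ(m) = sup {‖∑_{k ∈ A} x_k‖ : |A| ≤ m}`. For a norm-bounded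
sequence the set is bounded, so that the supremum is a genuine one. -/
def fundamentalFunction {F : Type*} [NormedAddCommGroup F] (x : ℕ → F) (m : ℕ) : ℝ :=
  ⨆ A : {A : Finset ℕ // A.card ≤ m}, ‖∑ k ∈ A.1, x k‖

/-- The basis `x` with dual basis `x'` is bidemocratic: `φ(m) φ*(m) ≤ Δ m`. -/
def Bidemocratic (x : ℕ → E) (x' : ℕ → StrongDual 𝕜 E) : Prop :=
  ∃ Δ : ℝ, ∀ m : ℕ, 1 ≤ m → fundamentalFunction x m * fundamentalFunction x' m ≤ Δ * m

/-- The coordinate projection `S_A f = ∑_{n ∈ A} x'_n(f) x_n`. -/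
def coordProj (x : ℕ → E) (x' : ℕ → StrongDual 𝕜 E) (A : Finset ℕ) (f : E) : E :=
  ∑ n ∈ A, x' n f • x n

/-- `A` is a greedy set of `f`. -/
def IsGreedySet (x' : ℕ → StrongDual 𝕜 E) (f : E) (A : Finset ℕ) : Prop :=
  ∀ n ∈ A, ∀ k ∉ A, ‖x' k f‖ ≤ ‖x' n f‖

/-- The projections on greedy sets are uniformly bounded. -/
def QuasiGreedy (x : ℕ → E) (x' : ℕ → StrongDual 𝕜 E) : Prop :=
  ∃ C : ℝ, ∀ (f : E) (A : Finset ℕ), IsGreedySet x' f A → ‖coordProj x x' A f‖ ≤ C * ‖f‖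

/-- All coordinate projections on finite sets are uniformly bounded. -/
def Unconditional (x : ℕ → E) (x' : ℕ → StrongDual 𝕜 E) : Prop :=
  ∃ C : ℝ, ∀ (f : E) (A : Finset ℕ), ‖coordProj x x' A f‖ ≤ C * ‖f‖

/-- A basis is conditional if it is not unconditional. -/
def Conditional (x : ℕ → E) (x' : ℕ → StrongDual 𝕜 E) : Prop :=
  ¬ Unconditional x x'

end Bases

/-- The rotated sequence `x ⋄ y` in `X × Y` (which carries the maximum norm):
`z_{2n-1} = (x_n, y_n) / √2` and `z_{2n} = (x_n, -y_n) / √2` for `n = 1, 2, …`. -/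
def rotation (𝕜 : Type*) [RCLike 𝕜] {X Y : Type*} [NormedAddCommGroup X] [NormedSpace 𝕜 X]
    [NormedAddCommGroup Y] [NormedSpace 𝕜 Y] (x : ℕ → X) (y : ℕ → Y) (n : ℕ) : X × Y :=
  ((Real.sqrt 2 : ℝ) : 𝕜)⁻¹ •
    (if Even n then (x (n / 2), y (n / 2)) else (x (n / 2), - y (n / 2)))

/-- `u_m ≈ v_m` for `m = 1, 2, …`. -/
def Equivalent (u v : ℕ → ℝ) : Prop :=
  ∃ c C : ℝ, 0 < c ∧ 0 < C ∧ ∀ m : ℕ, 1 ≤ m → c * v m ≤ u m ∧ u m ≤ C * v m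

/-! ### Lorentz and Marcinkiewicz sequence spaces -/

/-- The weight `(w_n)` whose primitive weight is `(s_m)_{m ≥ 1}`: `w_1 = s_1` and
`w_n = s_n - s_{n-1}` for `n ≥ 2`. The entry with index `n` of the Lean sequence is `w_{n+1}`,
and the value `s 0` is not used. -/
def weightOf (s : ℕ → ℝ) : ℕ → ℝ
  | 0 => s 1
  | n + 1 => s (n + 2) - s (n + 1)

theorem sum_weightOf (s : ℕ → ℝ) (m : ℕ) :
    ∑ n ∈ Finset.range (m + 1), weightOf s n = s (m + 1) := by
  induction m with
  | zero => simp [weightOf]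
  | succ m ih => rw [Finset.sum_range_succ, ih]; simp [weightOf]

section Spaces

variable {𝕜 : Type*} [RCLike 𝕜]

/-- The non-increasing rearrangement `(a_n)` of `(|f_k|)`; the value at `n` is `a_{n+1}`, the
least `t` such that at most `n` of the numbers `|f_k|` are larger than `t`. -/
def rearrangement (f : ℕ → 𝕜) (n : ℕ) : ℝ≥0∞ :=
  sInf {t : ℝ≥0∞ | {k : ℕ | t < ‖f k‖ₑ}.encard ≤ n}

/-- The gauge `∑ a_n w_n` of `d_{1,1}(w)`. -/
def lorentzGauge (w : ℕ → ℝ) (f : ℕ → 𝕜) : ℝ≥0∞ :=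
  ∑' n, rearrangement f n * ENNReal.ofReal (w n)

/-- The gauge `sup_m (a_1 + ⋯ + a_m) / (w_1 + ⋯ + w_m)` of the Marcinkiewicz space `m(w)`. -/
def marcinkiewiczGauge (w : ℕ → ℝ) (f : ℕ → 𝕜) : ℝ≥0∞ :=
  ⨆ m : ℕ, (∑ n ∈ Finset.range (m + 1), rearrangement f n) /
    ENNReal.ofReal (∑ n ∈ Finset.range (m + 1), w n)

/-- Membership in `d_{1,1}(w)`. -/
def MemLorentz (w : ℕ → ℝ) (f : ℕ → 𝕜) : Prop :=
  Tendsto f atTop (𝓝 0) ∧ lorentzGauge w f < ∞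

/-- Membership in `m(w)`. -/
def MemMarcinkiewicz (w : ℕ → ℝ) (f : ℕ → 𝕜) : Prop :=
  Tendsto f atTop (𝓝 0) ∧ marcinkiewiczGauge w f < ∞

/-- Membership in `m_0(w)`, the closure in `m(w)` of the finitely supported sequences. -/
def MemMarcinkiewiczZero (w : ℕ → ℝ) (f : ℕ → 𝕜) : Prop :=
  MemMarcinkiewicz w f ∧
    ∀ ε : ℝ≥0∞, 0 < ε → ∃ g : ℕ → 𝕜, g.support.Finite ∧ marcinkiewiczGauge w (f - g) < ε

variable {X : Type*} [NormedAddCommGroup X] [NormedSpace 𝕜 X]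

/-- Via the identification `J` of its elements with sequences, `X` is the space `d_{1,1}(w)`
endowed with a norm that is equivalent to its gauge. (For weights that are not non-increasing the
gauge itself is only a quasi-norm.) -/
structure IsLorentzSpace (w : ℕ → ℝ) (J : X →ₗ[𝕜] (ℕ → 𝕜)) : Prop where
  injective : Function.Injective J
  range_eq : ∀ f : ℕ → 𝕜, f ∈ Set.range J ↔ MemLorentz w f
  norm_equiv : ∃ c C : ℝ, 0 < c ∧ 0 < C ∧ ∀ x : X,
    ENNReal.ofReal c * lorentzGauge w (J x) ≤ ‖x‖ₑ ∧
      ‖x‖ₑ ≤ ENNReal.ofReal C * lorentzGauge w (J x)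

/-- Via the identification `J` of its elements with sequences, `X` is the space `m_0(w)` with its
own norm. -/
structure IsMarcinkiewiczZeroSpace (w : ℕ → ℝ) (J : X →ₗ[𝕜] (ℕ → 𝕜)) : Prop where
  injective : Function.Injective J
  range_eq : ∀ f : ℕ → 𝕜, f ∈ Set.range J ↔ MemMarcinkiewiczZero w f
  enorm_eq : ∀ x : X, ‖x‖ₑ = marcinkiewiczGauge w (J x)

end Spaces

end GreedyBasis

end

/-!
Let `σ` and `τ(m) = m / σ(m)` be the primitives of the weights `w` and `w*`. Both spaces are
treated as instances of one construction. A *weight family* is a set of weights `g` on `ℕ` with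
`∑_{n ∈ D} g_n ≤ σ(|D|)` for all finite `D`, which contains the uniform weights `(σ(|D|) / |D|)
1_D`; its gauge is `sup_g ∑ g_n |f_n|`. This is a lattice norm, lower semicontinuous for pointwise
convergence, so the closure of the finitely supported sequences is a Banach space with the unit
vectors as a basis. The smallest weight family yields the Marcinkiewicz space `m_0(w*)`
isometrically (`isMarcinkiewiczZeroSpace`), the largest one the Lorentz space `d_{1,1}(w)`
(`isLorentzSpace`). Both identifications run through an enumeration of the support of `f` in which
`|f|` does not increase, and Abel summation against it. For the Lorentz space, the weight `w` need
not be non-increasing, and it is replaced by the increments of a concave majorant of `σ` that lies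
below `2 σ`; its dominated partial sums make it, up to a factor, a member of the family.

All that is used of the two spaces in the positive results on the rotated basis is that they come
from weight families for the same `σ`: a sequence bounded by `α` on `D` and zero elsewhere has norm
at most `α σ(|D|)` (`WeightFamily.norm_le_add`), and `∑_{n ∈ D} |f_n| ≤ τ(|D|) ‖f‖`
(`WeightFamily.mul_sum_norm_le`). These give `φ ≈ σ` and `φ* ≲ τ`, hence bidemocracy, and also
quasi-greediness (`WeightFamily.quasiGreedy_rotation`): the only harm a greedy set can do is to split
a pair of coordinates, and over a split pair the two components differ by no more than the smallest
selected coefficient.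

The rotated basis is conditional because an unconditional one would force the two norms to be
equivalent. They are not: for a sequence `m_j` along which `σ` and `τ` at least double, the
sequence `∑_{j < J} 1_{[0, m_j)} / σ(m_j)` has Marcinkiewicz norm at most `4`, while its pairing with
the weight `∑_{j < J} 1_{[0, m_j)} / τ(m_j)`, four times a member of the largest family, is at least
`J`.
-/

noncomputable section

namespace GreedyBasis

open scoped NNReal
open Finset (range)

/-! ### Weight families and their gauges -/

/-- A quasi-concave function on `ℕ` vanishing at `0`: `σ` and `m ↦ m / σ m` are non-decreasing, the
latter being stated without division. -/
structure QuasiConcave (σ : ℕ → ℝ≥0) : Prop where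
  zero : σ 0 = 0
  pos : ∀ m, 1 ≤ m → 0 < σ m
  mono : Monotone σ
  ratio : ∀ m n, m ≤ n → m * σ n ≤ n * σ m

/-- The weight `(σ(|D|) / |D|) 1_D` of total mass `σ(|D|)` on `D`; it vanishes for `D = ∅`. -/
def uniformWeight (σ : ℕ → ℝ≥0) (D : Finset ℕ) : ℕ → ℝ≥0 :=
  (D : Set ℕ).indicator fun _ => σ D.card / D.card

/-- A set of weights on `ℕ` each of which gives mass at most `σ(|D|)` to every finite set `D`,
and which contains all the weights `uniformWeight σ D`. The associated gauge is a lattice norm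
whose fundamental function is `σ`. -/
structure WeightFamily (σ : ℕ → ℝ≥0) where
  /-- The weights of the family. -/
  carrier : Set (ℕ → ℝ≥0)
  pos : 0 < σ 1
  zero : σ 0 = 0
  uniformWeight_mem : ∀ D, uniformWeight σ D ∈ carrier
  sum_le : ∀ g ∈ carrier, ∀ D : Finset ℕ, ∑ n ∈ D, g n ≤ σ D.card

theorem sum_uniformWeight (σ : ℕ → ℝ≥0) (D A : Finset ℕ) :
    ∑ n ∈ A, uniformWeight σ D n = (A ∩ D).card * (σ D.card / D.card) := by
  classical
  unfold uniformWeight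
  simp only [Set.indicator_apply, Finset.mem_coe]
  rw [← Finset.sum_filter, Finset.sum_const, nsmul_eq_mul, Finset.filter_mem_eq_inter]

theorem QuasiConcave.sum_uniformWeight_le {σ : ℕ → ℝ≥0} (hσ : QuasiConcave σ) (D A : Finset ℕ) :
    ∑ n ∈ A, uniformWeight σ D n ≤ σ A.card := by
  rw [sum_uniformWeight]
  rcases D.eq_empty_or_nonempty with rfl | hD
  · simp
  have hD' : (0 : ℝ≥0) < D.card := by exact_mod_cast hD.card_pos
  calc ((A ∩ D).card : ℝ≥0) * (σ D.card / D.card)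
      = ((A ∩ D).card * σ D.card) / D.card := by ring
    _ ≤ (D.card * σ (A ∩ D).card) / D.card := by
        refine div_le_div_of_nonneg_right ?_ zero_le
        exact hσ.ratio _ _ (Finset.card_le_card Finset.inter_subset_right)
    _ = σ (A ∩ D).card := by field_simp
    _ ≤ σ A.card := hσ.mono (Finset.card_le_card Finset.inter_subset_left)

/-- The largest weight family, whose space is the Lorentz space `d_{1,1}`. -/
def maximalFamily {σ : ℕ → ℝ≥0} (hσ : QuasiConcave σ) : WeightFamily σ where
  carrier := {g | ∀ D : Finset ℕ, ∑ n ∈ D, g n ≤ σ D.card}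
  pos := hσ.pos 1 le_rfl
  zero := hσ.zero
  uniformWeight_mem D := hσ.sum_uniformWeight_le D
  sum_le _ hg := hg

/-- The smallest weight family, whose space is the Marcinkiewicz space `m_0`. -/
def minimalFamily {σ : ℕ → ℝ≥0} (hσ : QuasiConcave σ) : WeightFamily σ where
  carrier := Set.range (uniformWeight σ)
  pos := hσ.pos 1 le_rfl
  zero := hσ.zero
  uniformWeight_mem D := ⟨D, rfl⟩
  sum_le := by
    rintro _ ⟨D, rfl⟩ A
    exact hσ.sum_uniformWeight_le D A

namespace WeightFamily

variable {𝕜 : Type*} [RCLike 𝕜] {σ : ℕ → ℝ≥0} (W : WeightFamily σ)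

/-- The gauge `sup_g ∑ g_n |f_n|` of a weight family. -/
def gauge (f : ℕ → 𝕜) : ℝ≥0∞ :=
  ⨆ g ∈ W.carrier, ∑' n, (g n : ℝ≥0∞) * ‖f n‖ₑ

variable {W}

theorem le_gauge {g : ℕ → ℝ≥0} (hg : g ∈ W.carrier) (f : ℕ → 𝕜) :
    ∑' n, (g n : ℝ≥0∞) * ‖f n‖ₑ ≤ W.gauge f :=
  le_iSup₂ (f := fun g (_ : g ∈ W.carrier) => ∑' n, (g n : ℝ≥0∞) * ‖f n‖ₑ) g hg

theorem gauge_le {f : ℕ → 𝕜} {c : ℝ≥0∞}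
    (h : ∀ g ∈ W.carrier, ∑' n, (g n : ℝ≥0∞) * ‖f n‖ₑ ≤ c) : W.gauge f ≤ c :=
  iSup₂_le h

theorem gauge_zero : W.gauge (0 : ℕ → 𝕜) = 0 :=
  le_antisymm (gauge_le fun g _ => by simp) zero_le

theorem gauge_add_le (f g : ℕ → 𝕜) : W.gauge (f + g) ≤ W.gauge f + W.gauge g := by
  refine gauge_le fun w hw => ?_
  calc ∑' n, (w n : ℝ≥0∞) * ‖(f + g) n‖ₑ
      ≤ ∑' n, ((w n : ℝ≥0∞) * ‖f n‖ₑ + (w n : ℝ≥0∞) * ‖g n‖ₑ) := by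
        refine ENNReal.tsum_le_tsum fun n => ?_
        rw [← mul_add]
        exact mul_le_mul_right (enorm_add_le _ _) _
    _ ≤ _ := by
        rw [ENNReal.tsum_add]
        exact add_le_add (le_gauge hw f) (le_gauge hw g)

theorem gauge_smul_le (c : 𝕜) (f : ℕ → 𝕜) : W.gauge (c • f) ≤ ‖c‖ₑ * W.gauge f := by
  refine gauge_le fun w hw => ?_
  calc ∑' n, (w n : ℝ≥0∞) * ‖(c • f) n‖ₑ = ‖c‖ₑ * ∑' n, (w n : ℝ≥0∞) * ‖f n‖ₑ := by
        rw [← ENNReal.tsum_mul_left]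
        refine tsum_congr fun n => ?_
        rw [Pi.smul_apply, smul_eq_mul, enorm_mul]
        ring
    _ ≤ _ := mul_le_mul_right (le_gauge hw f) _

theorem gauge_smul (c : 𝕜) (f : ℕ → 𝕜) : W.gauge (c • f) = ‖c‖ₑ * W.gauge f := by
  rcases eq_or_ne c 0 with rfl | hc
  · simp [gauge_zero]
  refine le_antisymm (gauge_smul_le c f) ?_
  calc ‖c‖ₑ * W.gauge f = ‖c‖ₑ * W.gauge (c⁻¹ • c • f) := by rw [inv_smul_smul₀ hc]
    _ ≤ ‖c‖ₑ * (‖c⁻¹‖ₑ * W.gauge (c • f)) := by gcongr; exact gauge_smul_le _ _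
    _ = W.gauge (c • f) := by
        rw [← mul_assoc, ← enorm_mul, mul_inv_cancel₀ hc, enorm_one, one_mul]

/-- Dually to the bound `σ(|D|)` for the gauge of `1_D`, the functional `∑_{n ∈ D} |f_n|` is
bounded by `|D| / σ(|D|)`. -/
theorem mul_sum_enorm_le (D : Finset ℕ) (f : ℕ → 𝕜) :
    (σ D.card : ℝ≥0∞) * ∑ n ∈ D, ‖f n‖ₑ ≤ D.card * W.gauge f := by
  rcases D.eq_empty_or_nonempty with rfl | hD
  · simp
  have hD' : (D.card : ℝ≥0) ≠ 0 := by exact_mod_cast hD.card_pos.ne'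
  have h := le_gauge (W.uniformWeight_mem D) f
  rw [tsum_eq_sum (s := D) (fun n hn => by simp [uniformWeight, hn])] at h
  calc (σ D.card : ℝ≥0∞) * ∑ n ∈ D, ‖f n‖ₑ
      = D.card * ∑ n ∈ D, (uniformWeight σ D n : ℝ≥0∞) * ‖f n‖ₑ := by
        rw [Finset.mul_sum, Finset.mul_sum]
        refine Finset.sum_congr rfl fun n hn => ?_
        rw [← mul_assoc]
        congr 1
        simp only [uniformWeight, Set.indicator_of_mem (Finset.mem_coe.2 hn)]
        rw [← ENNReal.coe_natCast, ← ENNReal.coe_mul, mul_div_cancel₀ _ hD']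
    _ ≤ _ := by gcongr

theorem enorm_apply_le (f : ℕ → 𝕜) (n : ℕ) : (σ 1 : ℝ≥0∞) * ‖f n‖ₑ ≤ W.gauge f := by
  simpa using W.mul_sum_enorm_le {n} f

theorem weight_le {g : ℕ → ℝ≥0} (hg : g ∈ W.carrier) (n : ℕ) : g n ≤ σ 1 := by
  simpa using W.sum_le g hg {n}

/-- Control of a sequence that is dominated by another one up to a constant on a finite set. -/
theorem gauge_le_add {p f : ℕ → 𝕜} {α : ℝ≥0} {D : Finset ℕ}
    (h : ∀ n, ‖p n‖ₑ ≤ ‖f n‖ₑ + if n ∈ D then (α : ℝ≥0∞) else 0) :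
    W.gauge p ≤ W.gauge f + α * σ D.card := by
  refine gauge_le fun w hw => ?_
  calc ∑' n, (w n : ℝ≥0∞) * ‖p n‖ₑ
      ≤ ∑' n, ((w n : ℝ≥0∞) * ‖f n‖ₑ + (w n : ℝ≥0∞) * if n ∈ D then (α : ℝ≥0∞) else 0) := by
        refine ENNReal.tsum_le_tsum fun n => ?_
        rw [← mul_add]
        exact mul_le_mul_right (h n) _
    _ ≤ _ := by
        rw [ENNReal.tsum_add]
        refine add_le_add (le_gauge hw f) ?_
        rw [tsum_eq_sum (s := D) (fun n hn => by simp [hn]),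
          Finset.sum_congr rfl fun n hn => by rw [if_pos hn], ← Finset.sum_mul, mul_comm]
        refine mul_le_mul_right ?_ _
        exact_mod_cast W.sum_le w hw D

theorem gauge_lt_top_of_finite {f : ℕ → 𝕜} (hf : f.support.Finite) : W.gauge f < ∞ := by
  have hle : W.gauge f ≤ ∑ n ∈ hf.toFinset, (σ 1 : ℝ≥0∞) * ‖f n‖ₑ := by
    refine gauge_le fun w hw => ?_
    rw [tsum_eq_sum (s := hf.toFinset) fun n hn => by
      simp only [Set.Finite.mem_toFinset, Function.mem_support, not_not] at hn; simp [hn]]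
    gcongr
    exact weight_le hw _
  refine hle.trans_lt (ENNReal.sum_lt_top.2 fun n _ => ?_)
  exact ENNReal.mul_lt_top ENNReal.coe_lt_top (by simp)

/-- The gauge is lower semicontinuous for pointwise convergence. -/
theorem isClosed_gauge_le (c : ℝ≥0∞) : IsClosed {f : ℕ → 𝕜 | W.gauge f ≤ c} := by
  have : {f : ℕ → 𝕜 | W.gauge f ≤ c} = ⋂ g ∈ W.carrier, ⋂ S : Finset ℕ,
      {f | ∑ n ∈ S, (g n : ℝ≥0∞) * ‖f n‖ₑ ≤ c} := by
    ext f
    simp [gauge, ENNReal.tsum_eq_iSup_sum]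
  rw [this]
  refine isClosed_biInter fun g _ => isClosed_iInter fun S => isClosed_le ?_ continuous_const
  refine continuous_finsetSum _ fun n _ => ?_
  exact (ENNReal.continuous_const_mul ENNReal.coe_ne_top).comp
    (continuous_enorm.comp (continuous_apply n))

/-! ### The Banach space of a weight family -/

variable (W) (𝕜)

/-- The sequences that are approximated by finitely supported ones in the gauge of `W`. -/
def submodule : Submodule 𝕜 (ℕ → 𝕜) where
  carrier := {f | ∀ ε : ℝ≥0∞, 0 < ε → ∃ g : ℕ → 𝕜, g.support.Finite ∧ W.gauge (f - g) < ε}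
  zero_mem' ε hε := ⟨0, by simp, by simpa [gauge_zero] using hε⟩
  add_mem' := by
    intro f₁ f₂ h₁ h₂ ε hε
    obtain ⟨g₁, hg₁, h₁⟩ := h₁ (ε / 2) (ENNReal.half_pos hε.ne')
    obtain ⟨g₂, hg₂, h₂⟩ := h₂ (ε / 2) (ENNReal.half_pos hε.ne')
    refine ⟨g₁ + g₂, (hg₁.union hg₂).subset (Function.support_add _ _), ?_⟩
    calc W.gauge (f₁ + f₂ - (g₁ + g₂)) = W.gauge ((f₁ - g₁) + (f₂ - g₂)) := by
          congr 1; abel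
      _ ≤ _ := gauge_add_le _ _
      _ < ε / 2 + ε / 2 := ENNReal.add_lt_add h₁ h₂
      _ = ε := ENNReal.add_halves ε
  smul_mem' := by
    intro c f h ε hε
    rcases eq_or_ne c 0 with rfl | hc
    · exact ⟨0, by simp, by simpa [gauge_zero] using hε⟩
    have hc' : ‖c‖ₑ ≠ 0 := by simpa using hc
    obtain ⟨g, hg, h⟩ := h (ε / ‖c‖ₑ) (ENNReal.div_pos hε.ne' (by simp))
    refine ⟨c • g, hg.subset (Function.support_const_smul_subset c g), ?_⟩
    rw [← smul_sub, gauge_smul, mul_comm]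
    exact (ENNReal.lt_div_iff_mul_lt (Or.inl hc') (Or.inl (by simp))).1 h

/-- The Banach space of the sequences in `W.submodule 𝕜`, normed by the gauge. This is a type
synonym, so that it does not carry the topology of pointwise convergence. -/
def Space : Type _ := W.submodule 𝕜

instance : AddCommGroup (W.Space 𝕜) := inferInstanceAs (AddCommGroup (W.submodule 𝕜))

instance : Module 𝕜 (W.Space 𝕜) := inferInstanceAs (Module 𝕜 (W.submodule 𝕜))

/-- The sequence of coefficients of an element. -/
def coeff : W.Space 𝕜 →ₗ[𝕜] (ℕ → 𝕜) := (W.submodule 𝕜).subtype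

variable {𝕜 W}

theorem coeff_injective : Function.Injective (W.coeff 𝕜) := Subtype.val_injective

theorem mem_range_coeff {f : ℕ → 𝕜} : f ∈ Set.range (W.coeff 𝕜) ↔
    ∀ ε : ℝ≥0∞, 0 < ε → ∃ g : ℕ → 𝕜, g.support.Finite ∧ W.gauge (f - g) < ε := by
  constructor
  · rintro ⟨x, rfl⟩
    exact x.2
  · intro h
    exact ⟨⟨f, h⟩, rfl⟩

theorem mem_range_coeff_of_finite {f : ℕ → 𝕜} (hf : f.support.Finite) :
    f ∈ Set.range (W.coeff 𝕜) :=
  mem_range_coeff.2 fun ε hε => ⟨f, hf, by simpa [gauge_zero] using hε⟩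

theorem gauge_coeff_lt_top (x : W.Space 𝕜) : W.gauge (W.coeff 𝕜 x) < ∞ := by
  obtain ⟨g, hg, h⟩ := mem_range_coeff.1 ⟨x, rfl⟩ 1 one_pos
  calc W.gauge (W.coeff 𝕜 x) = W.gauge ((W.coeff 𝕜 x - g) + g) := by rw [sub_add_cancel]
    _ ≤ _ := gauge_add_le _ _
    _ < ∞ := ENNReal.add_lt_top.2 ⟨h.trans ENNReal.one_lt_top, gauge_lt_top_of_finite hg⟩

theorem tendsto_coeff (x : W.Space 𝕜) : Tendsto (W.coeff 𝕜 x) atTop (𝓝 0) := by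
  rw [Metric.tendsto_atTop]
  intro ε hε
  have h1 : (0 : ℝ≥0∞) < σ 1 := by exact_mod_cast W.pos
  obtain ⟨g, hg, h⟩ := mem_range_coeff.1 ⟨x, rfl⟩ (σ 1 * ENNReal.ofReal ε)
    (ENNReal.mul_pos h1.ne' (by simpa using hε))
  obtain ⟨N, hN⟩ := hg.bddAbove
  refine ⟨N + 1, fun n hn => ?_⟩
  have hgn : g n = 0 := by
    by_contra hne
    exact absurd (hN hne) (by omega)
  have := (enorm_apply_le (W.coeff 𝕜 x - g) n).trans_lt h
  rw [ENNReal.mul_lt_mul_iff_right h1.ne' ENNReal.coe_ne_top, Pi.sub_apply, hgn, sub_zero,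
    ← ofReal_norm, ENNReal.ofReal_lt_ofReal_iff hε] at this
  simpa using this

instance : Norm (W.Space 𝕜) := ⟨fun x => (W.gauge (W.coeff 𝕜 x)).toReal⟩

theorem norm_def (x : W.Space 𝕜) : ‖x‖ = (W.gauge (W.coeff 𝕜 x)).toReal := rfl

theorem normedSpaceCore : NormedSpace.Core 𝕜 (W.Space 𝕜) where
  norm_nonneg _ := ENNReal.toReal_nonneg
  norm_smul c x := by rw [norm_def, map_smul, gauge_smul, ENNReal.toReal_mul, norm_def]; simp
  norm_triangle x y := by
    rw [norm_def, norm_def, norm_def, ← ENNReal.toReal_add (gauge_coeff_lt_top x).ne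
      (gauge_coeff_lt_top y).ne, map_add]
    exact ENNReal.toReal_mono (ENNReal.add_lt_top.2
      ⟨gauge_coeff_lt_top x, gauge_coeff_lt_top y⟩).ne (gauge_add_le _ _)
  norm_eq_zero_iff x := by
    constructor
    · intro h
      rw [norm_def, ENNReal.toReal_eq_zero_iff, or_iff_left (gauge_coeff_lt_top x).ne] at h
      refine coeff_injective (funext fun n => ?_)
      have := enorm_apply_le (W := W) (W.coeff 𝕜 x) n
      rw [h, nonpos_iff_eq_zero, mul_eq_zero] at this
      simpa [W.pos.ne'] using this
    · rintro rfl
      simp [norm_def, gauge_zero]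

instance : NormedAddCommGroup (W.Space 𝕜) := NormedAddCommGroup.ofCore normedSpaceCore

instance : NormedSpace 𝕜 (W.Space 𝕜) := NormedSpace.ofCore normedSpaceCore

theorem enorm_eq_gauge (x : W.Space 𝕜) : ‖x‖ₑ = W.gauge (W.coeff 𝕜 x) := by
  rw [← ofReal_norm, norm_def, ENNReal.ofReal_toReal (gauge_coeff_lt_top x).ne]

theorem norm_coeff_le (x : W.Space 𝕜) (n : ℕ) : ‖W.coeff 𝕜 x n‖ ≤ (σ 1 : ℝ)⁻¹ * ‖x‖ := by
  have h1 : (0 : ℝ) < σ 1 := by exact_mod_cast W.pos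
  rw [inv_mul_eq_div, le_div_iff₀' h1]
  have := enorm_apply_le (W := W) (W.coeff 𝕜 x) n
  rw [← enorm_eq_gauge] at this
  have := ENNReal.toReal_mono (by simp) this
  simpa using this

variable (W 𝕜)

/-- The coordinate functionals, which are the dual basis of the unit vectors. -/
def coord (n : ℕ) : StrongDual 𝕜 (W.Space 𝕜) :=
  ((LinearMap.proj n).comp (W.coeff 𝕜)).mkContinuous (σ 1 : ℝ)⁻¹ fun x => norm_coeff_le x n

variable {W 𝕜}

@[simp] theorem coord_apply (n : ℕ) (x : W.Space 𝕜) : W.coord 𝕜 n x = W.coeff 𝕜 x n := rfl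

/-- Completeness: the pointwise limit of a Cauchy sequence is its limit in the gauge, by lower
semicontinuity of the gauge. -/
instance : CompleteSpace (W.Space 𝕜) := by
  refine Metric.complete_of_cauchySeq_tendsto fun u hu => ?_
  have hpt : ∀ n, ∃ l, Tendsto (fun k => W.coeff 𝕜 (u k) n) atTop (𝓝 l) := fun n =>
    cauchySeq_tendsto_of_complete (hu.map (W.coord 𝕜 n).uniformContinuous)
  choose F hF using hpt
  have hlim : Tendsto (fun k => W.coeff 𝕜 (u k)) atTop (𝓝 F) := tendsto_pi_nhds.2 hF
  have key : ∀ ε : ℝ≥0∞, 0 < ε → ∃ N, ∀ m ≥ N, W.gauge (F - W.coeff 𝕜 (u m)) ≤ ε := by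
    intro ε hε
    obtain ⟨N, hN⟩ := EMetric.cauchySeq_iff.1 hu ε hε
    refine ⟨N, fun m hm => ?_⟩
    refine (isClosed_gauge_le ε).mem_of_tendsto (hlim.sub_const _) ?_
    filter_upwards [eventually_ge_atTop N] with k hk
    have := (hN k hk m hm).le
    rwa [edist_eq_enorm_sub, enorm_eq_gauge, map_sub] at this
  have hmem : F ∈ Set.range (W.coeff 𝕜) := by
    refine mem_range_coeff.2 fun ε hε => ?_
    have h3 : 0 < ε / 2 := ENNReal.half_pos hε.ne'
    -- The additivity of strict inequalities used below requires a finite `ε / 2`.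
    rcases eq_or_ne ε ∞ with rfl | hε'
    · obtain ⟨N, hN⟩ := key 1 one_pos
      obtain ⟨g, hg, h⟩ := mem_range_coeff.1 ⟨u N, rfl⟩ 1 one_pos
      refine ⟨g, hg, ?_⟩
      calc W.gauge (F - g) = W.gauge ((F - W.coeff 𝕜 (u N)) + (W.coeff 𝕜 (u N) - g)) := by
            rw [sub_add_sub_cancel]
        _ ≤ _ := gauge_add_le _ _
        _ < ∞ := ENNReal.add_lt_top.2 ⟨(hN N le_rfl).trans_lt ENNReal.one_lt_top,
            h.trans ENNReal.one_lt_top⟩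
    obtain ⟨N, hN⟩ := key (ε / 2) h3
    obtain ⟨g, hg, h⟩ := mem_range_coeff.1 ⟨u N, rfl⟩ (ε / 2) h3
    refine ⟨g, hg, ?_⟩
    calc W.gauge (F - g) = W.gauge ((F - W.coeff 𝕜 (u N)) + (W.coeff 𝕜 (u N) - g)) := by
          rw [sub_add_sub_cancel]
      _ ≤ _ := gauge_add_le _ _
      _ < ε / 2 + ε / 2 := ENNReal.add_lt_add_of_le_of_lt
          ((hN N le_rfl).trans_lt (ENNReal.half_lt_self hε.ne' hε' |>.trans_le le_top)).ne
          (hN N le_rfl) h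
      _ = ε := ENNReal.add_halves ε
  obtain ⟨x, rfl⟩ := hmem
  refine ⟨x, EMetric.tendsto_atTop.2 fun ε hε => ?_⟩
  obtain ⟨δ, hδ, hδε⟩ := exists_between hε
  obtain ⟨N, hN⟩ := key δ hδ
  refine ⟨N, fun m hm => ?_⟩
  rw [edist_comm, edist_eq_enorm_sub, enorm_eq_gauge, map_sub]
  exact (hN m hm).trans_lt hδε

variable (W 𝕜)

/-- The element with a given finitely supported sequence of coefficients. -/
def ofFinite (f : ℕ → 𝕜) (hf : f.support.Finite) : W.Space 𝕜 :=
  ⟨f, fun _ hε => ⟨f, hf, by simpa [gauge_zero] using hε⟩⟩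

/-- The unit vectors. -/
def unit (n : ℕ) : W.Space 𝕜 :=
  W.ofFinite 𝕜 (Pi.single n 1) ((Set.finite_singleton n).subset Pi.support_single_subset)

variable {W 𝕜}

@[simp] theorem coeff_ofFinite (f : ℕ → 𝕜) (hf : f.support.Finite) :
    W.coeff 𝕜 (W.ofFinite 𝕜 f hf) = f := rfl

@[simp] theorem coeff_unit (n : ℕ) : W.coeff 𝕜 (W.unit 𝕜 n) = Pi.single n 1 := rfl

/-- The real form of `gauge_le_add`. -/
theorem norm_le_add {p f : W.Space 𝕜} {α : ℝ} (hα : 0 ≤ α) {D : Finset ℕ}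
    (h : ∀ n, ‖W.coeff 𝕜 p n‖ ≤ ‖W.coeff 𝕜 f n‖ + if n ∈ D then α else 0) :
    ‖p‖ ≤ ‖f‖ + α * σ D.card := by
  lift α to ℝ≥0 using hα
  have := gauge_le_add (W := W) (p := W.coeff 𝕜 p) (f := W.coeff 𝕜 f) (α := α) (D := D) fun n => by
    have := h n
    rw [← ofReal_norm, ← ofReal_norm]
    have h0 : (if n ∈ D then (α : ℝ≥0∞) else 0) = ENNReal.ofReal (if n ∈ D then (α : ℝ) else 0) := by
      split_ifs <;> simp
    rw [h0, ← ENNReal.ofReal_add (norm_nonneg _) (by split_ifs <;> simp)]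
    exact ENNReal.ofReal_le_ofReal this
  rw [← enorm_eq_gauge, ← enorm_eq_gauge] at this
  have := ENNReal.toReal_mono (by simp [ENNReal.mul_eq_top]) this
  rwa [ENNReal.toReal_add (by simp) (by simp [ENNReal.mul_eq_top]), ENNReal.toReal_mul,
    toReal_enorm, toReal_enorm] at this

/-- The real form of `mul_sum_enorm_le`. -/
theorem mul_sum_norm_le (D : Finset ℕ) (f : W.Space 𝕜) :
    (σ D.card : ℝ) * ∑ n ∈ D, ‖W.coeff 𝕜 f n‖ ≤ D.card * ‖f‖ := by
  have := mul_sum_enorm_le (W := W) D (W.coeff 𝕜 f)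
  rw [← enorm_eq_gauge] at this
  have := ENNReal.toReal_mono (by simp [ENNReal.mul_eq_top]) this
  simpa [ENNReal.toReal_sum] using this

theorem isBasis : IsBasis (W.unit 𝕜) (W.coord 𝕜) where
  bounded := by
    refine ⟨σ 1, fun n => ?_⟩
    have := norm_le_add (W := W) (p := W.unit 𝕜 n) (f := 0) zero_le_one (D := {n}) fun k => by
      by_cases hk : k = n
      · subst hk; simp
      · simp [hk]
    simpa using this
  bounded_dual := ⟨(σ 1 : ℝ)⁻¹, fun n => LinearMap.mkContinuous_norm_le _ (by positivity) _⟩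
  dense_span := by
    refine EMetric.dense_iff.2 fun x ε hε => ?_
    obtain ⟨g, hg, h⟩ := mem_range_coeff.1 ⟨x, rfl⟩ ε hε
    refine ⟨W.ofFinite 𝕜 g hg, ?_, ?_⟩
    · rw [Metric.mem_eball, edist_comm, edist_eq_enorm_sub, enorm_eq_gauge, map_sub]
      exact h
    · have : W.ofFinite 𝕜 g hg = ∑ n ∈ hg.toFinset, g n • W.unit 𝕜 n := by
        refine coeff_injective (funext fun k => ?_)
        simp only [coeff_ofFinite, map_sum, map_smul, coeff_unit, Finset.sum_apply, Pi.smul_apply,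
          Pi.single_apply, smul_eq_mul, mul_ite, mul_one, mul_zero, Finset.sum_ite_eq,
          Set.Finite.mem_toFinset, Function.mem_support]
        split_ifs with h0
        · rfl
        · simpa using h0
      rw [this]
      exact Submodule.sum_mem _ fun n _ =>
        Submodule.smul_mem _ _ (Submodule.subset_span ⟨n, rfl⟩)
  biorthogonal n k := by
    simp [Pi.single_apply]

end WeightFamily

/-! ### Non-increasing sequences and greedy enumerations -/

/-- Abel summation: among weights, domination of the partial sums suffices for domination of the
sums against a non-increasing sequence. -/
theorem sum_mul_le_sum_mul {a p q : ℕ → ℝ≥0} (ha : Antitone a)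
    (h : ∀ m, ∑ i ∈ range m, p i ≤ ∑ i ∈ range m, q i) (m : ℕ) :
    ∑ i ∈ range m, p i * a i ≤ ∑ i ∈ range m, q i * a i := by
  have key : ∀ m, (a m : ℝ) * (∑ i ∈ range (m + 1), (q i : ℝ) - ∑ i ∈ range (m + 1), (p i : ℝ)) ≤
      ∑ i ∈ range (m + 1), (q i * a i : ℝ) - ∑ i ∈ range (m + 1), (p i * a i : ℝ) := by
    intro m
    induction m with
    | zero => simp; linarith
    | succ m ih =>
      have h1 : (a (m + 1) : ℝ) ≤ a m := by exact_mod_cast ha (Nat.le_succ m)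
      have h2 : ∑ i ∈ range (m + 1), (p i : ℝ) ≤ ∑ i ∈ range (m + 1), (q i : ℝ) := by
        exact_mod_cast h (m + 1)
      have h3 := mul_le_mul_of_nonneg_right h1 (sub_nonneg.2 h2)
      simp only [Finset.sum_range_succ _ (m + 1)]
      linarith
  cases m with
  | zero => simp
  | succ m =>
    have h2 : ∑ i ∈ range (m + 1), (p i : ℝ) ≤ ∑ i ∈ range (m + 1), (q i : ℝ) := by
      exact_mod_cast h (m + 1)
    have h3 := mul_nonneg (a m).coe_nonneg (sub_nonneg.2 h2)
    have := h3.trans (key m)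
    rw [sub_nonneg] at this
    exact_mod_cast this

theorem tsum_mul_le_tsum_mul {a p q : ℕ → ℝ≥0} (ha : Antitone a)
    (h : ∀ m, ∑ i ∈ range m, p i ≤ ∑ i ∈ range m, q i) :
    ∑' i, (p i * a i : ℝ≥0∞) ≤ ∑' i, (q i * a i : ℝ≥0∞) := by
  refine ENNReal.tsum_le_of_sum_range_le fun m => ?_
  refine le_trans ?_ (ENNReal.sum_le_tsum (range m))
  exact_mod_cast sum_mul_le_sum_mul ha h m

theorem sum_le_sum_range_card {M : Type*} [AddCommMonoid M] [PartialOrder M]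
    [IsOrderedAddMonoid M] {a : ℕ → M} (ha : Antitone a) (B : Finset ℕ) :
    ∑ i ∈ B, a i ≤ ∑ i ∈ range B.card, a i := by
  induction B using Finset.induction_on_max with
  | empty => simp
  | insert k B hk ih =>
    have hkB : k ∉ B := fun h => lt_irrefl _ (hk k h)
    have hle : B.card ≤ k := by
      simpa using Finset.card_le_card (fun x hx => Finset.mem_range.2 (hk x hx) : B ⊆ range k)
    rw [Finset.sum_insert hkB, Finset.card_insert_of_notMem hkB, Finset.sum_range_succ, add_comm]
    exact add_le_add ih (ha hle)

variable {𝕜 : Type*} [RCLike 𝕜]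

/-- The injective sequence `π` runs through the support of `f` in an order in which `|f|` does not
increase (and, if the support is finite, goes on with zeros of `f`). -/
structure IsGreedyEnumeration (f : ℕ → 𝕜) (π : ℕ → ℕ) : Prop where
  injective : Function.Injective π
  antitone : Antitone fun n => ‖f (π n)‖₊
  support_subset : f.support ⊆ Set.range π

theorem exists_forall_norm_le {f : ℕ → 𝕜} (hf : Tendsto f atTop (𝓝 0)) (A : Finset ℕ) :
    ∃ k ∉ A, ∀ j ∉ A, ‖f j‖ ≤ ‖f k‖ := by
  by_cases h0 : ∀ j ∉ A, f j = 0
  · obtain ⟨k, hk⟩ := Infinite.exists_notMem_finset A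
    exact ⟨k, hk, fun j hj => by simp [h0 j hj]⟩
  push Not at h0
  obtain ⟨k₀, hk₀, hne⟩ := h0
  have hev := hf.norm.eventually (gt_mem_nhds (by simpa using hne : ‖(0 : 𝕜)‖ < ‖f k₀‖))
  obtain ⟨N, hN⟩ := eventually_atTop.1 hev
  obtain ⟨k, hk, hmax⟩ := ((range (max N k₀ + 1)).filter (· ∉ A)).exists_max_image (fun j => ‖f j‖)
    ⟨k₀, by simp [hk₀]⟩
  rw [Finset.mem_filter] at hk
  refine ⟨k, hk.2, fun j hj => ?_⟩
  rcases lt_or_ge j (max N k₀ + 1) with hlt | hge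
  · exact hmax j (by simp only [Finset.mem_filter, Finset.mem_range]; exact ⟨hlt, hj⟩)
  · exact (hN j (by omega)).le.trans (hmax k₀ (by simp [hk₀]))

theorem exists_isGreedyEnumeration {f : ℕ → 𝕜} (hf : Tendsto f atTop (𝓝 0)) :
    ∃ π, IsGreedyEnumeration f π := by
  choose next hnext hmax using exists_forall_norm_le hf
  -- `S n` consists of the first `n` indices that are picked.
  let S : ℕ → Finset ℕ := fun n => n.rec ∅ fun _ A => insert (next A) A
  have hS : ∀ n, S (n + 1) = insert (next (S n)) (S n) := fun _ => rfl
  have hSmono : Monotone S := monotone_nat_of_le_succ fun n => by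
    rw [hS]; exact Finset.subset_insert _ _
  have hmem : ∀ m n, m < n → next (S m) ∈ S n := fun m n hmn =>
    hSmono (Nat.succ_le_of_lt hmn) (by rw [Nat.succ_eq_add_one, hS]; exact Finset.mem_insert_self _ _)
  have hinj : Function.Injective fun n => next (S n) := by
    intro m n hmn
    dsimp only at hmn
    rcases lt_trichotomy m n with h | h | h
    · exact absurd (hmn ▸ hmem m n h) (hnext _)
    · exact h
    · exact absurd (hmn ▸ hmem n m h) (hnext _)
  have hSrange : ∀ n, ∀ k ∈ S n, k ∈ Set.range fun n => next (S n) := by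
    intro n
    induction n with
    | zero => intro k hk; simp [S] at hk
    | succ n ih =>
      intro k hk
      rw [hS, Finset.mem_insert] at hk
      rcases hk with rfl | hk
      · exact ⟨n, rfl⟩
      · exact ih k hk
  refine ⟨fun n => next (S n), hinj, antitone_nat_of_succ_le fun n => ?_, fun k hk => ?_⟩
  · exact hmax _ _ fun h => hnext (S (n + 1)) (hSmono (Nat.le_succ n) h)
  · by_contra hnot
    have h1 : Tendsto (fun n => ‖f (next (S n))‖) atTop (𝓝 0) := by
      have := (hf.comp (hinj.nat_tendsto_atTop)).norm
      simpa using this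
    have h2 : ‖f k‖ ≤ 0 := ge_of_tendsto' h1 fun n => hmax _ _ fun h => hnot (hSrange n k h)
    exact hk (by simpa using h2)

namespace IsGreedyEnumeration

variable {f : ℕ → 𝕜} {π : ℕ → ℕ}

theorem rearrangement_eq (h : IsGreedyEnumeration f π) (n : ℕ) :
    rearrangement f n = ‖f (π n)‖ₑ := by
  have hanti : ∀ i j, i ≤ j → ‖f (π j)‖ₑ ≤ ‖f (π i)‖ₑ := fun i j hij => by
    rw [enorm_eq_nnnorm, enorm_eq_nnnorm]
    exact_mod_cast h.antitone hij
  have hcard : ∀ m, ((fun i => π i) '' (range m : Set ℕ)).encard = m := fun m => by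
    rw [h.injective.injOn.encard_image, Set.encard_coe_eq_coe_finsetCard, Finset.card_range]
  refine le_antisymm (sInf_le ?_) (le_sInf fun t ht => ?_)
  · refine (Set.encard_le_encard fun k hk => ?_).trans (hcard n).le
    obtain ⟨i, rfl⟩ := h.support_subset (show f k ≠ 0 by rintro h0; simp [h0] at hk)
    refine ⟨i, ?_, rfl⟩
    simp only [Finset.coe_range, Set.mem_Iio]
    by_contra hle
    exact absurd (hanti n i (not_lt.1 hle)) (not_le.2 hk)
  · by_contra hlt
    have hsub : (fun i => π i) '' (range (n + 1) : Set ℕ) ⊆ {k | t < ‖f k‖ₑ} := by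
      rintro _ ⟨i, hi, rfl⟩
      have : i < n + 1 := by simpa using hi
      exact (not_le.1 hlt).trans_le (hanti i n (by omega))
    have := (hcard (n + 1)).ge.trans ((Set.encard_le_encard hsub).trans ht)
    have : n + 1 ≤ n := by exact_mod_cast this
    omega

theorem tsum_eq (h : IsGreedyEnumeration f π) (g : ℕ → ℝ≥0) :
    ∑' k, (g k : ℝ≥0∞) * ‖f k‖ₑ = ∑' n, (g (π n) : ℝ≥0∞) * ‖f (π n)‖ₑ := by
  refine (h.injective.tsum_eq (f := fun k => (g k : ℝ≥0∞) * ‖f k‖ₑ) fun k hk => ?_).symm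
  exact h.support_subset fun h0 => hk (by simp [h0])

/-- Every finite set of entries is dominated by as many entries from the start. -/
theorem sum_enorm_le (h : IsGreedyEnumeration f π) (D : Finset ℕ) :
    ∑ k ∈ D, ‖f k‖ₑ ≤ ∑ n ∈ range D.card, ‖f (π n)‖ₑ := by
  classical
  have hanti : Antitone fun n => ‖f (π n)‖ₑ := fun i j hij => by
    simp only [enorm_eq_nnnorm]
    exact_mod_cast h.antitone hij
  calc ∑ k ∈ D, ‖f k‖ₑ = ∑ k ∈ D.filter (· ∈ Set.range π), ‖f k‖ₑ := by
        refine (Finset.sum_filter_of_ne fun k _ hk => ?_).symm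
        exact h.support_subset fun h0 => hk (by simp [h0])
    _ = ∑ n ∈ D.preimage π h.injective.injOn, ‖f (π n)‖ₑ :=
        (Finset.sum_preimage' π D h.injective.injOn fun k => ‖f k‖ₑ).symm
    _ ≤ ∑ n ∈ range (D.preimage π h.injective.injOn).card, ‖f (π n)‖ₑ :=
        sum_le_sum_range_card hanti _
    _ ≤ _ := by
        refine Finset.sum_le_sum_of_subset (Finset.range_mono ?_)
        exact Finset.card_le_card_of_injOn π (fun n hn => by simpa using hn) h.injective.injOn

variable {σ : ℕ → ℝ≥0}

theorem gauge_le_tsum (h : IsGreedyEnumeration f π) (W : WeightFamily σ) {w : ℕ → ℝ≥0}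
    (hw : ∀ m, ∑ n ∈ range m, w n = σ m) : W.gauge f ≤ ∑' n, (w n : ℝ≥0∞) * ‖f (π n)‖ₑ := by
  refine WeightFamily.gauge_le fun g hg => ?_
  rw [h.tsum_eq]
  refine tsum_mul_le_tsum_mul (a := fun n => ‖f (π n)‖₊) h.antitone fun m => ?_
  rw [hw]
  simpa [Finset.sum_image h.injective.injOn, Finset.card_image_of_injective _ h.injective]
    using W.sum_le g hg ((range m).image π)

end IsGreedyEnumeration

/-! ### The gauge of the minimal family is the Marcinkiewicz gauge -/

theorem gauge_minimalFamily {σ : ℕ → ℝ≥0} (hσ : QuasiConcave σ) {f : ℕ → 𝕜}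
    (hf : Tendsto f atTop (𝓝 0)) {w : ℕ → ℝ}
    (hw : ∀ m, ∑ n ∈ range (m + 1), w n = ((m + 1 : ℕ) / σ (m + 1) : ℝ≥0)) :
    (minimalFamily hσ).gauge f = marcinkiewiczGauge w f := by
  obtain ⟨π, hπ⟩ := exists_isGreedyEnumeration hf
  have hterm : ∀ m : ℕ, ∀ c : ℝ≥0∞, c / ENNReal.ofReal (∑ n ∈ range (m + 1), w n) =
      ((σ (m + 1) / (m + 1 : ℕ) : ℝ≥0) : ℝ≥0∞) * c := by
    intro m c
    have h1 := (hσ.pos (m + 1) (by omega)).ne'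
    have h2 : ((m + 1 : ℕ) : ℝ≥0) ≠ 0 := by positivity
    rw [hw, ENNReal.ofReal_coe_nnreal, div_eq_mul_inv, ← ENNReal.coe_inv (div_ne_zero h2 h1),
      inv_div, mul_comm]
  have hunif : ∀ D : Finset ℕ, ∑' n, (uniformWeight σ D n : ℝ≥0∞) * ‖f n‖ₑ =
      ((σ D.card / D.card : ℝ≥0) : ℝ≥0∞) * ∑ n ∈ D, ‖f n‖ₑ := by
    intro D
    rw [tsum_eq_sum (s := D) (fun n hn => by simp [uniformWeight, hn]), Finset.mul_sum]
    refine Finset.sum_congr rfl fun n hn => ?_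
    simp only [uniformWeight, Set.indicator_of_mem (Finset.mem_coe.2 hn)]
  unfold marcinkiewiczGauge
  simp_rw [hterm, hπ.rearrangement_eq]
  refine le_antisymm (WeightFamily.gauge_le ?_) (iSup_le fun m => ?_)
  · rintro _ ⟨D, rfl⟩
    rw [hunif]
    rcases D.eq_empty_or_nonempty with rfl | hD
    · simp
    obtain ⟨m, hm⟩ := Nat.exists_eq_succ_of_ne_zero hD.card_pos.ne'
    refine le_trans ?_ (le_iSup _ m)
    rw [← Nat.succ_eq_add_one, ← hm]
    gcongr
    exact hπ.sum_enorm_le D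
  · have := WeightFamily.le_gauge ((minimalFamily hσ).uniformWeight_mem ((range (m + 1)).image π)) f
    rw [hunif, Finset.card_image_of_injective _ hπ.injective, Finset.card_range,
      Finset.sum_image hπ.injective.injOn] at this
    exact this

theorem isMarcinkiewiczZeroSpace {σ : ℕ → ℝ≥0} (hσ : QuasiConcave σ) {w : ℕ → ℝ}
    (hw : ∀ m, ∑ n ∈ range (m + 1), w n = ((m + 1 : ℕ) / σ (m + 1) : ℝ≥0)) :
    IsMarcinkiewiczZeroSpace w ((minimalFamily hσ).coeff 𝕜) where
  injective := WeightFamily.coeff_injective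
  range_eq f := by
    have hsub : Tendsto f atTop (𝓝 0) → ∀ g : ℕ → 𝕜, g.support.Finite →
        (minimalFamily hσ).gauge (f - g) = marcinkiewiczGauge w (f - g) := by
      intro hf g hg
      obtain ⟨y, rfl⟩ := WeightFamily.mem_range_coeff_of_finite (W := minimalFamily hσ) hg
      refine gauge_minimalFamily hσ ?_ hw
      have := hf.sub (WeightFamily.tendsto_coeff y)
      rwa [sub_zero] at this
    constructor
    · rintro ⟨x, rfl⟩
      have h0 := WeightFamily.tendsto_coeff x
      refine ⟨⟨h0, ?_⟩, fun ε hε => ?_⟩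
      · rw [← gauge_minimalFamily hσ h0 hw]
        exact WeightFamily.gauge_coeff_lt_top x
      · obtain ⟨g, hg, h⟩ := WeightFamily.mem_range_coeff.1 ⟨x, rfl⟩ ε hε
        exact ⟨g, hg, by rwa [← hsub h0 g hg]⟩
    · rintro ⟨⟨h0, -⟩, h⟩
      refine WeightFamily.mem_range_coeff.2 fun ε hε => ?_
      obtain ⟨g, hg, h⟩ := h ε hε
      exact ⟨g, hg, by rwa [hsub h0 g hg]⟩
  enorm_eq x := by
    rw [WeightFamily.enorm_eq_gauge, gauge_minimalFamily hσ (WeightFamily.tendsto_coeff x) hw]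

/-! ### The gauge of the maximal family is equivalent to the Lorentz gauge -/

/-- A quasi-concave function is equivalent, within a factor `2`, to the primitive of a
non-increasing weight. -/
theorem QuasiConcave.exists_antitone {σ : ℕ → ℝ≥0} (hσ : QuasiConcave σ) :
    ∃ v : ℕ → ℝ≥0, Antitone v ∧
      ∀ m, σ m ≤ ∑ n ∈ range m, v n ∧ ∑ n ∈ range m, v n ≤ 2 * σ m := by
  -- `V` is an infimum of affine functions, hence concave; the `k`-th one lies above `σ`, and
  -- below `2 σ` at the point `k + 1`.
  let V : ℕ → ℝ≥0 := fun m => if m = 0 then 0 else ⨅ k : ℕ, (1 + m / (k + 1 : ℕ)) * σ (k + 1)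
  have hV : ∀ m, V (m + 1) = ⨅ k : ℕ, (1 + (m + 1 : ℕ) / (k + 1 : ℕ)) * σ (k + 1) := fun m =>
    if_neg (Nat.succ_ne_zero m)
  have hVle : ∀ m k : ℕ, V m ≤ (1 + m / (k + 1 : ℕ)) * σ (k + 1) := by
    intro m k
    rcases m with _ | m
    · simp [V]
    · rw [hV]
      exact ciInf_le (OrderBot.bddBelow _) k
  have hconc : ∀ m, V m + V (m + 2) ≤ 2 * V (m + 1) := by
    intro m
    rw [hV m, NNReal.mul_iInf]
    refine le_ciInf fun k => (add_le_add (hVle m k) (hVle (m + 2) k)).trans_eq ?_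
    push_cast
    ring
  have hmono : Monotone V := by
    refine monotone_nat_of_le_succ fun m => ?_
    rw [hV]
    refine le_ciInf fun k => (hVle m k).trans ?_
    gcongr
    exact Nat.le_succ m
  refine ⟨fun n => V (n + 1) - V n, antitone_nat_of_succ_le fun n => ?_, fun m => ?_⟩
  · have h1 : V n ≤ V (n + 1) := hmono (Nat.le_succ n)
    have h2 : V (n + 1) ≤ V (n + 2) := hmono (Nat.le_succ (n + 1))
    have h3 := hconc n
    rw [← NNReal.coe_le_coe, NNReal.coe_sub h1, NNReal.coe_sub h2]
    have h4 : (V n + V (n + 2) : ℝ) ≤ 2 * V (n + 1) := by exact_mod_cast h3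
    have h5 : (V (n + 1 + 1) : ℝ) = V (n + 2) := rfl
    linarith
  · rw [Finset.sum_range_tsub hmono, show V 0 = 0 from if_pos rfl, tsub_zero]
    rcases m with _ | m
    · simp [V, hσ.zero]
    refine ⟨?_, ?_⟩
    · rw [hV]
      refine le_ciInf fun k => ?_
      rcases le_total (m + 1) (k + 1) with h | h
      · refine (hσ.mono h).trans ?_
        rw [add_mul, one_mul]
        exact le_add_of_nonneg_right zero_le
      · have hk : (0 : ℝ≥0) < (k + 1 : ℕ) := by positivity
        calc σ (m + 1) = ((k + 1 : ℕ) * σ (m + 1)) / (k + 1 : ℕ) := by field_simp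
          _ ≤ ((m + 1 : ℕ) * σ (k + 1)) / (k + 1 : ℕ) :=
            div_le_div_of_nonneg_right (hσ.ratio _ _ h) zero_le
          _ = ((m + 1 : ℕ) / (k + 1 : ℕ)) * σ (k + 1) := by ring
          _ ≤ _ := by gcongr; exact le_add_of_nonneg_left zero_le
    · refine (hVle (m + 1) m).trans_eq ?_
      rw [div_self (by positivity), one_add_one_eq_two]

/-- The weight that witnesses the lower bound is the non-increasing weight of
`QuasiConcave.exists_antitone`, halved and transported along the greedy enumeration. -/
theorem IsGreedyEnumeration.tsum_le_gauge {σ : ℕ → ℝ≥0} (hσ : QuasiConcave σ) {f : ℕ → 𝕜}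
    {π : ℕ → ℕ} (h : IsGreedyEnumeration f π) {w : ℕ → ℝ≥0}
    (hw : ∀ m, ∑ n ∈ range m, w n = σ m) :
    ∑' n, (w n : ℝ≥0∞) * ‖f (π n)‖ₑ ≤ 2 * (maximalFamily hσ).gauge f := by
  classical
  obtain ⟨v, hv, hvσ⟩ := hσ.exists_antitone
  let g : ℕ → ℝ≥0 := Function.extend π (fun n => v n / 2) 0
  have hgπ : ∀ n, g (π n) = v n / 2 := fun n => h.injective.extend_apply _ _ n
  have hg : g ∈ (maximalFamily hσ).carrier := by
    intro D
    calc ∑ k ∈ D, g k = ∑ k ∈ D.filter (· ∈ Set.range π), g k := by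
          refine (Finset.sum_filter_of_ne fun k _ hk => ?_).symm
          by_contra hnot
          exact hk (Function.extend_apply' _ _ k hnot)
      _ = ∑ n ∈ D.preimage π h.injective.injOn, g (π n) :=
          (Finset.sum_preimage' π D h.injective.injOn g).symm
      _ = (∑ n ∈ D.preimage π h.injective.injOn, v n) / 2 := by
          simp_rw [hgπ, Finset.sum_div]
      _ ≤ (∑ n ∈ range (D.preimage π h.injective.injOn).card, v n) / 2 := by
          exact div_le_div_of_nonneg_right (sum_le_sum_range_card hv _) zero_le
      _ ≤ (2 * σ (D.preimage π h.injective.injOn).card) / 2 := by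
          exact div_le_div_of_nonneg_right (hvσ _).2 zero_le
      _ = σ (D.preimage π h.injective.injOn).card := by field_simp
      _ ≤ σ D.card := hσ.mono
          (Finset.card_le_card_of_injOn π (fun n hn => by simpa using hn) h.injective.injOn)
  calc ∑' n, (w n : ℝ≥0∞) * ‖f (π n)‖ₑ ≤ ∑' n, (v n : ℝ≥0∞) * ‖f (π n)‖ₑ :=
        tsum_mul_le_tsum_mul (a := fun n => ‖f (π n)‖₊) h.antitone fun m => by
          rw [hw]; exact (hvσ m).1
    _ = 2 * ∑' n, (g (π n) : ℝ≥0∞) * ‖f (π n)‖ₑ := by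
        rw [← ENNReal.tsum_mul_left]
        refine tsum_congr fun n => ?_
        rw [← mul_assoc, hgπ, ← ENNReal.coe_two, ← ENNReal.coe_mul, mul_div_cancel₀ _ two_ne_zero]
    _ = 2 * ∑' k, (g k : ℝ≥0∞) * ‖f k‖ₑ := by rw [h.tsum_eq]
    _ ≤ _ := by gcongr; exact WeightFamily.le_gauge hg f

theorem IsGreedyEnumeration.lorentzGauge_eq {f : ℕ → 𝕜} {π : ℕ → ℕ}
    (h : IsGreedyEnumeration f π) (w : ℕ → ℝ) :
    lorentzGauge w f = ∑' n, ((w n).toNNReal : ℝ≥0∞) * ‖f (π n)‖ₑ := by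
  unfold lorentzGauge
  refine tsum_congr fun n => ?_
  rw [h.rearrangement_eq, mul_comm, ENNReal.ofReal]

/-- Finitely supported sequences are dense in the Lorentz space: removing the `N` largest
entries shifts the rearrangement by `N`, and dominated convergence applies. -/
theorem IsGreedyEnumeration.exists_gauge_sub_lt {σ : ℕ → ℝ≥0} (W : WeightFamily σ) {f : ℕ → 𝕜}
    (hf : Tendsto f atTop (𝓝 0)) {π : ℕ → ℕ} (h : IsGreedyEnumeration f π) {w : ℕ → ℝ≥0}
    (hw : ∀ m, ∑ n ∈ range m, w n = σ m) (hfin : ∑' n, (w n : ℝ≥0∞) * ‖f (π n)‖ₑ ≠ ∞)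
    {ε : ℝ≥0∞} (hε : 0 < ε) :
    ∃ g : ℕ → 𝕜, g.support.Finite ∧ W.gauge (f - g) < ε := by
  classical
  have hsum : Summable fun n => w n * ‖f (π n)‖₊ := by
    rw [← ENNReal.tsum_coe_ne_top_iff_summable]
    simpa [enorm_eq_nnnorm] using hfin
  have hlim : Tendsto (fun N => ∑' n, (w n * ‖f (π (n + N))‖₊ : ℝ)) atTop (𝓝 0) := by
    have h0 : Tendsto (fun N => ∑' n, (w n * ‖f (π (n + N))‖₊ : ℝ)) atTop
        (𝓝 (∑' _ : ℕ, (0 : ℝ))) := by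
      refine tendsto_tsum_of_dominated_convergence (NNReal.summable_coe.2 hsum) (fun n => ?_)
        (Eventually.of_forall fun N n => ?_)
      · have hπ := h.injective.nat_tendsto_atTop.comp (tendsto_add_atTop_nat n)
        have := ((hf.comp hπ).norm).const_mul (w n : ℝ)
        simpa [add_comm] using this
      · rw [Real.norm_of_nonneg (by positivity)]
        have : ‖f (π (n + N))‖₊ ≤ ‖f (π n)‖₊ := h.antitone (Nat.le_add_right n N)
        push_cast
        gcongr
        exact this
    simpa using h0
  rcases eq_or_ne ε ∞ with rfl | hεt
  · refine ⟨0, by simp, ?_⟩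
    rw [sub_zero]
    exact (h.gauge_le_tsum W hw).trans_lt hfin.lt_top
  obtain ⟨N, hN⟩ := (hlim.eventually (gt_mem_nhds (ENNReal.toReal_pos hε.ne' hεt))).exists
  let A := (range N).image π
  let g : ℕ → 𝕜 := fun k => if k ∈ A then f k else 0
  have hπA : ∀ n, π n ∈ A ↔ n < N := fun n => by
    simp [A, h.injective.eq_iff]
  have hshift : ∀ n, (f - g) (π (n + N)) = f (π (n + N)) := fun n => by
    have : π (n + N) ∉ A := by rw [hπA]; omega
    simp [g, this]
  have hg : IsGreedyEnumeration (f - g) fun n => π (n + N) := by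
    refine ⟨fun m n hmn => by simpa using h.injective hmn, ?_, fun k hk => ?_⟩
    · simp only [hshift]
      exact fun m n hmn => h.antitone (Nat.add_le_add_right hmn N)
    · have hkA : k ∉ A := fun hkA => hk (by simp [g, hkA])
      have hfk : f k ≠ 0 := by simpa [g, hkA] using hk
      obtain ⟨n, rfl⟩ := h.support_subset hfk
      rw [hπA, not_lt] at hkA
      exact ⟨n - N, by simp [Nat.sub_add_cancel hkA]⟩
  refine ⟨g, A.finite_toSet.subset fun k hk => ?_, ?_⟩
  · by_contra hkA
    exact hk (if_neg hkA)
  · refine (hg.gauge_le_tsum W hw).trans_lt ?_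
    have hs : Summable fun n => w n * ‖f (π (n + N))‖₊ := by
      refine NNReal.summable_of_le (fun n => ?_) hsum
      gcongr
      exact h.antitone (Nat.le_add_right n N)
    simp only [hshift, enorm_eq_nnnorm, ← ENNReal.coe_mul]
    rw [← ENNReal.coe_tsum hs, ← ENNReal.ofReal_coe_nnreal, ENNReal.ofReal_lt_iff_lt_toReal
      (by positivity) hεt, NNReal.coe_tsum]
    exact_mod_cast hN

theorem isLorentzSpace {σ : ℕ → ℝ≥0} (hσ : QuasiConcave σ) {w : ℕ → ℝ}
    (hw : ∀ m, ∑ n ∈ range m, (w n).toNNReal = σ m) :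
    IsLorentzSpace w ((maximalFamily hσ).coeff 𝕜) where
  injective := WeightFamily.coeff_injective
  range_eq f := by
    constructor
    · rintro ⟨x, rfl⟩
      have h0 := WeightFamily.tendsto_coeff x
      obtain ⟨π, hπ⟩ := exists_isGreedyEnumeration h0
      refine ⟨h0, ?_⟩
      rw [hπ.lorentzGauge_eq]
      exact (hπ.tsum_le_gauge hσ hw).trans_lt
        (ENNReal.mul_lt_top (by simp) (WeightFamily.gauge_coeff_lt_top x))
    · rintro ⟨h0, hfin⟩
      obtain ⟨π, hπ⟩ := exists_isGreedyEnumeration h0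
      rw [hπ.lorentzGauge_eq] at hfin
      exact WeightFamily.mem_range_coeff.2 fun ε hε =>
        hπ.exists_gauge_sub_lt _ h0 hw hfin.ne hε
  norm_equiv := by
    refine ⟨1 / 2, 1, by norm_num, one_pos, fun x => ?_⟩
    obtain ⟨π, hπ⟩ := exists_isGreedyEnumeration (WeightFamily.tendsto_coeff x)
    rw [hπ.lorentzGauge_eq, WeightFamily.enorm_eq_gauge, ENNReal.ofReal_one, one_mul]
    refine ⟨?_, hπ.gauge_le_tsum _ hw⟩
    rw [one_div, ENNReal.ofReal_inv_of_pos two_pos, ENNReal.ofReal_ofNat, mul_comm,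
      ← div_eq_mul_inv]
    exact ENNReal.div_le_of_le_mul' (hπ.tsum_le_gauge hσ hw)

/-! ### Rotations of bases -/

section Rotation

variable {𝕜 : Type*} [RCLike 𝕜] {X Y : Type*} [NormedAddCommGroup X] [NormedSpace 𝕜 X]
  [NormedAddCommGroup Y] [NormedSpace 𝕜 Y]

/-- The dual basis `(x'_k, ± y'_k) / √2`, with `k = n / 2` and the sign `(-1)^n`, of a rotated
basis. -/
def rotationDual (x' : ℕ → StrongDual 𝕜 X) (y' : ℕ → StrongDual 𝕜 Y) (n : ℕ) :
    StrongDual 𝕜 (X × Y) :=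
  ((Real.sqrt 2 : ℝ) : 𝕜)⁻¹ • (x' (n / 2)).coprod ((-1 : 𝕜) ^ n • y' (n / 2))

theorem rotation_eq (x : ℕ → X) (y : ℕ → Y) (n : ℕ) : rotation 𝕜 x y n =
    ((Real.sqrt 2 : ℝ) : 𝕜)⁻¹ • (x (n / 2), (-1 : 𝕜) ^ n • y (n / 2)) := by
  unfold rotation
  split_ifs with h
  · rw [h.neg_one_pow, one_smul]
  · rw [(Nat.not_even_iff_odd.1 h).neg_one_pow, neg_smul, one_smul]

theorem rotationDual_apply (x' : ℕ → StrongDual 𝕜 X) (y' : ℕ → StrongDual 𝕜 Y) (n : ℕ)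
    (f : X × Y) : rotationDual x' y' n f =
      ((Real.sqrt 2 : ℝ) : 𝕜)⁻¹ * (x' (n / 2) f.1 + (-1) ^ n * y' (n / 2) f.2) := by
  simp [rotationDual]

theorem inv_sqrt_two_mul_self :
    ((Real.sqrt 2 : ℝ) : 𝕜)⁻¹ * ((Real.sqrt 2 : ℝ) : 𝕜)⁻¹ = 2⁻¹ := by
  rw [← mul_inv, ← RCLike.ofReal_mul, Real.mul_self_sqrt zero_le_two, RCLike.ofReal_ofNat]

theorem norm_inv_sqrt_two : ‖((Real.sqrt 2 : ℝ) : 𝕜)⁻¹‖ = (Real.sqrt 2)⁻¹ := by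
  rw [norm_inv, RCLike.norm_ofReal, abs_of_nonneg (Real.sqrt_nonneg 2)]

theorem inv_sqrt_two_le_one : (Real.sqrt 2)⁻¹ ≤ 1 :=
  inv_le_one_of_one_le₀ (Real.one_le_sqrt.2 one_le_two)

theorem half_le_inv_sqrt_two : (1 / 2 : ℝ) ≤ (Real.sqrt 2)⁻¹ := by
  rw [one_div]
  refine inv_anti₀ (by positivity) ?_
  rw [Real.sqrt_le_left zero_le_two]
  norm_num

theorem IsBasis.rotation {x : ℕ → X} {x' : ℕ → StrongDual 𝕜 X} {y : ℕ → Y}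
    {y' : ℕ → StrongDual 𝕜 Y} (hx : IsBasis x x') (hy : IsBasis y y') :
    IsBasis (rotation 𝕜 x y) (rotationDual x' y') where
  bounded := by
    obtain ⟨C, hC⟩ := hx.bounded
    obtain ⟨D, hD⟩ := hy.bounded
    refine ⟨max C D, fun n => ?_⟩
    rw [rotation_eq, norm_smul, norm_inv_sqrt_two]
    refine (mul_le_of_le_one_left (norm_nonneg _) inv_sqrt_two_le_one).trans ?_
    rw [Prod.norm_def, norm_smul, norm_pow, norm_neg, norm_one, one_pow, one_mul]
    exact max_le_max (hC _) (hD _)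
  bounded_dual := by
    obtain ⟨C, hC⟩ := hx.bounded_dual
    obtain ⟨D, hD⟩ := hy.bounded_dual
    have hC0 := (norm_nonneg _).trans (hC 0)
    have hD0 := (norm_nonneg _).trans (hD 0)
    refine ⟨C + D, fun n => ContinuousLinearMap.opNorm_le_bound _ (add_nonneg hC0 hD0) fun f => ?_⟩
    rw [rotationDual_apply, norm_mul, norm_inv_sqrt_two]
    refine (mul_le_of_le_one_left (norm_nonneg _) inv_sqrt_two_le_one).trans
      ((norm_add_le _ _).trans ?_)
    rw [norm_mul, norm_pow, norm_neg, norm_one, one_pow, one_mul, add_mul]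
    refine add_le_add ?_ ?_
    · exact (x' _).le_of_opNorm_le_of_le (hC _) (norm_fst_le f)
    · exact (y' _).le_of_opNorm_le_of_le (hD _) (norm_snd_le f)
  dense_span := by
    have hx' : ∀ a ∈ Submodule.span 𝕜 (Set.range x),
        (a, (0 : Y)) ∈ Submodule.span 𝕜 (Set.range (GreedyBasis.rotation 𝕜 x y)) := by
      suffices h : Submodule.span 𝕜 (Set.range x) ≤
          (Submodule.span 𝕜 (Set.range (GreedyBasis.rotation 𝕜 x y))).comap
            (LinearMap.inl 𝕜 X Y) from fun a ha => h ha
      rw [Submodule.span_le]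
      rintro _ ⟨n, rfl⟩
      have : LinearMap.inl 𝕜 X Y (x n) = ((Real.sqrt 2 : ℝ) : 𝕜)⁻¹ •
          (GreedyBasis.rotation 𝕜 x y (2 * n) + GreedyBasis.rotation 𝕜 x y (2 * n + 1)) := by
        rw [rotation_eq, rotation_eq, ← smul_add, smul_smul, inv_sqrt_two_mul_self,
          show (2 * n + 1) / 2 = n by omega, show 2 * n / 2 = n by omega, pow_succ, pow_mul]
        ext
        · simp [← two_smul 𝕜 (x n)]
        · simp
      rw [SetLike.mem_coe, Submodule.mem_comap, this]
      exact Submodule.smul_mem _ _ (Submodule.add_mem _ (Submodule.subset_span ⟨_, rfl⟩)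
        (Submodule.subset_span ⟨_, rfl⟩))
    have hy' : ∀ b ∈ Submodule.span 𝕜 (Set.range y),
        ((0 : X), b) ∈ Submodule.span 𝕜 (Set.range (GreedyBasis.rotation 𝕜 x y)) := by
      suffices h : Submodule.span 𝕜 (Set.range y) ≤
          (Submodule.span 𝕜 (Set.range (GreedyBasis.rotation 𝕜 x y))).comap
            (LinearMap.inr 𝕜 X Y) from fun b hb => h hb
      rw [Submodule.span_le]
      rintro _ ⟨n, rfl⟩
      have : LinearMap.inr 𝕜 X Y (y n) = ((Real.sqrt 2 : ℝ) : 𝕜)⁻¹ •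
          (GreedyBasis.rotation 𝕜 x y (2 * n) - GreedyBasis.rotation 𝕜 x y (2 * n + 1)) := by
        rw [rotation_eq, rotation_eq, ← smul_sub, smul_smul, inv_sqrt_two_mul_self,
          show (2 * n + 1) / 2 = n by omega, show 2 * n / 2 = n by omega, pow_succ, pow_mul]
        ext
        · simp
        · simp [← two_smul 𝕜 (y n)]
      rw [SetLike.mem_coe, Submodule.mem_comap, this]
      exact Submodule.smul_mem _ _ (Submodule.sub_mem _ (Submodule.subset_span ⟨_, rfl⟩)
        (Submodule.subset_span ⟨_, rfl⟩))
    refine (hx.dense_span.prod hy.dense_span).mono ?_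
    rintro ⟨a, b⟩ ⟨ha, hb⟩
    have := Submodule.add_mem _ (hx' a ha) (hy' b hb)
    simpa using this
  biorthogonal n k := by
    rw [rotationDual_apply, rotation_eq]
    simp only [Prod.smul_fst, Prod.smul_snd, map_smul, hx.biorthogonal, hy.biorthogonal,
      smul_eq_mul]
    by_cases h : n / 2 = k / 2
    · simp only [if_pos h, mul_one]
      have : ∀ c : 𝕜, c * (c + (-1) ^ n * (c * (-1) ^ k)) = c * c * (1 + (-1) ^ (n + k)) := by
        intro c; rw [pow_add]; ring
      rw [this, inv_sqrt_two_mul_self]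
      by_cases hnk : n = k
      · rw [if_pos hnk, hnk, (Even.add_self k).neg_one_pow, one_add_one_eq_two,
          inv_mul_cancel₀ two_ne_zero]
      · have : Odd (n + k) := by rw [Nat.odd_iff]; omega
        rw [if_neg hnk, this.neg_one_pow, add_neg_cancel, mul_zero]
    · rw [if_neg h, if_neg fun hnk => h (by rw [hnk])]
      simp

end Rotation

theorem sum_ite_div_two {M : Type*} [AddCommMonoid M] (A : Finset ℕ) (F : ℕ → M) (k : ℕ) :
    ∑ n ∈ A, (if n / 2 = k then F n else 0) =
      (if 2 * k ∈ A then F (2 * k) else 0) + if 2 * k + 1 ∈ A then F (2 * k + 1) else 0 := by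
  have h : A.filter (fun n => n / 2 = k) = ({2 * k, 2 * k + 1} : Finset ℕ).filter (· ∈ A) := by
    ext n
    simp only [Finset.mem_filter, Finset.mem_insert, Finset.mem_singleton]
    constructor
    · rintro ⟨h1, h2⟩; exact ⟨by omega, h1⟩
    · rintro ⟨h1, h2⟩; exact ⟨h2, by omega⟩
  rw [← Finset.sum_filter, h, Finset.sum_filter, Finset.sum_pair (by omega)]

theorem sum_div_two_le (A : Finset ℕ) {c : ℕ → ℝ} (hc : ∀ k, 0 ≤ c k) :
    ∑ n ∈ A, c (n / 2) ≤ 2 * ∑ k ∈ A.image (· / 2), c k := by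
  rw [← Finset.sum_fiberwise_of_maps_to (t := A.image (· / 2)) (g := (· / 2))
    fun n hn => Finset.mem_image_of_mem _ hn, Finset.mul_sum]
  refine Finset.sum_le_sum fun k _ => ?_
  rw [Finset.sum_filter, sum_ite_div_two A fun n => c (n / 2),
    show (2 * k + 1) / 2 = k by omega, show 2 * k / 2 = k by omega]
  have := hc k
  split_ifs <;> linarith

/-! ### Rotations of the unit vectors of two weight families -/

namespace WeightFamily

variable {𝕜 : Type*} [RCLike 𝕜] {σ : ℕ → ℝ≥0} {W₁ W₂ : WeightFamily σ}

/-- Only `n = 2k` and `n = 2k + 1` contribute to the coordinate `k` of a combination of the rotated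
unit vectors. -/
theorem coeff_sum_rotation_fst (A : Finset ℕ) (c : ℕ → 𝕜) (k : ℕ) :
    W₁.coeff 𝕜 (∑ n ∈ A, c n • rotation 𝕜 (W₁.unit 𝕜) (W₂.unit 𝕜) n).1 k =
      ((Real.sqrt 2 : ℝ) : 𝕜)⁻¹ * ((if 2 * k ∈ A then c (2 * k) else 0) +
        if 2 * k + 1 ∈ A then c (2 * k + 1) else 0) := by
  rw [← sum_ite_div_two, Finset.mul_sum, Prod.fst_sum, map_sum, Finset.sum_apply]
  refine Finset.sum_congr rfl fun n _ => ?_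
  rw [rotation_eq]
  simp only [Prod.smul_mk, map_smul, coeff_unit, Pi.smul_apply, Pi.single_apply, smul_eq_mul,
    eq_comm (a := k)]
  split_ifs <;> ring

theorem coeff_sum_rotation_snd (A : Finset ℕ) (c : ℕ → 𝕜) (k : ℕ) :
    W₂.coeff 𝕜 (∑ n ∈ A, c n • rotation 𝕜 (W₁.unit 𝕜) (W₂.unit 𝕜) n).2 k =
      ((Real.sqrt 2 : ℝ) : 𝕜)⁻¹ * ((if 2 * k ∈ A then c (2 * k) else 0) -
        if 2 * k + 1 ∈ A then c (2 * k + 1) else 0) := by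
  have h := sum_ite_div_two A (fun n => (-1 : 𝕜) ^ n * c n) k
  rw [pow_succ, pow_mul, neg_one_sq, one_pow, one_mul, one_mul, neg_one_mul,
    show (if 2 * k + 1 ∈ A then -c (2 * k + 1) else 0) =
      -(if 2 * k + 1 ∈ A then c (2 * k + 1) else 0) by split_ifs <;> simp, ← sub_eq_add_neg] at h
  rw [← h, Finset.mul_sum, Prod.snd_sum, map_sum, Finset.sum_apply]
  refine Finset.sum_congr rfl fun n _ => ?_
  rw [rotation_eq]
  simp only [Prod.smul_mk, map_smul, coeff_unit, Pi.smul_apply, Pi.single_apply, smul_eq_mul,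
    eq_comm (a := k)]
  split_ifs <;> ring

theorem norm_sum_rotation_le (hσ : Monotone σ) (A : Finset ℕ) :
    ‖∑ n ∈ A, rotation 𝕜 (W₁.unit 𝕜) (W₂.unit 𝕜) n‖ ≤ 2 * σ A.card := by
  have h1 := coeff_sum_rotation_fst (W₁ := W₁) (W₂ := W₂) A (fun _ => (1 : 𝕜))
  have h2 := coeff_sum_rotation_snd (W₁ := W₁) (W₂ := W₂) A (fun _ => (1 : 𝕜))
  simp only [one_smul] at h1 h2
  have hcard : (2 : ℝ) * σ (A.image (· / 2)).card ≤ 2 * σ A.card := by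
    have := hσ (Finset.card_image_le (s := A) (f := (· / 2)))
    gcongr
  have hmem : ∀ k, (2 * k ∈ A ∨ 2 * k + 1 ∈ A) → k ∈ A.image (· / 2) := by
    rintro k (h | h)
    · exact Finset.mem_image.2 ⟨_, h, by omega⟩
    · exact Finset.mem_image.2 ⟨_, h, by omega⟩
  have hbound : ∀ (k : ℕ) (t : 𝕜), ((2 * k ∉ A ∧ 2 * k + 1 ∉ A) → t = 0) → ‖t‖ ≤ 2 →
      ‖((Real.sqrt 2 : ℝ) : 𝕜)⁻¹ * t‖ ≤
        0 + if k ∈ A.image (· / 2) then (2 : ℝ) else 0 := by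
    intro k t ht ht2
    rw [zero_add, norm_mul, norm_inv_sqrt_two]
    split_ifs with hk
    · exact (mul_le_of_le_one_left (norm_nonneg _) inv_sqrt_two_le_one).trans ht2
    · rw [ht ⟨fun h => hk (hmem k (Or.inl h)), fun h => hk (hmem k (Or.inr h))⟩]
      simp
  rw [Prod.norm_def]
  refine max_le ?_ ?_
  · have := norm_le_add (f := 0) (D := A.image (· / 2))
      (p := (∑ n ∈ A, rotation 𝕜 (W₁.unit 𝕜) (W₂.unit 𝕜) n).1) zero_le_two fun k => by
        rw [h1, map_zero, Pi.zero_apply, norm_zero]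
        refine hbound k _ (fun h => by simp [h.1, h.2]) ?_
        split_ifs <;> norm_num
    rw [norm_zero, zero_add] at this
    exact this.trans hcard
  · have := norm_le_add (f := 0) (D := A.image (· / 2))
      (p := (∑ n ∈ A, rotation 𝕜 (W₁.unit 𝕜) (W₂.unit 𝕜) n).2) zero_le_two fun k => by
        rw [h2, map_zero, Pi.zero_apply, norm_zero]
        refine hbound k _ (fun h => by simp [h.1, h.2]) ?_
        split_ifs <;> norm_num
    rw [norm_zero, zero_add] at this
    exact this.trans hcard

theorem bddAbove_norm_sum_rotation (hσ : Monotone σ) (m : ℕ) :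
    BddAbove (Set.range fun A : {A : Finset ℕ // A.card ≤ m} =>
      ‖∑ n ∈ A.1, rotation 𝕜 (W₁.unit 𝕜) (W₂.unit 𝕜) n‖) := by
  refine ⟨2 * σ m, ?_⟩
  rintro _ ⟨A, rfl⟩
  refine (norm_sum_rotation_le hσ A.1).trans ?_
  have := hσ A.2
  gcongr

theorem fundamentalFunction_rotation_le (hσ : Monotone σ) (m : ℕ) :
    fundamentalFunction (rotation 𝕜 (W₁.unit 𝕜) (W₂.unit 𝕜)) m ≤ 2 * σ m := by
  have : Nonempty {A : Finset ℕ // A.card ≤ m} := ⟨⟨∅, by simp⟩⟩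
  refine ciSup_le fun A => (norm_sum_rotation_le hσ A.1).trans ?_
  have := hσ A.2
  gcongr

/-- The sum of `z_{2k}` over `k < m` has first component `1_{[0, m)} / √2`. -/
theorem le_fundamentalFunction_rotation (hσ : Monotone σ) {m : ℕ} (hm : 1 ≤ m) :
    1 / 2 * (σ m : ℝ) ≤ fundamentalFunction (rotation 𝕜 (W₁.unit 𝕜) (W₂.unit 𝕜)) m := by
  let A := (range m).image (2 * ·)
  have hA : A.card = m := by
    rw [Finset.card_image_of_injective _ (mul_right_injective₀ two_ne_zero), Finset.card_range]
  refine le_trans ?_ (le_ciSup (bddAbove_norm_sum_rotation hσ m) ⟨A, hA.le⟩)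
  refine le_trans ?_ (norm_fst_le _)
  have h1 := coeff_sum_rotation_fst (W₁ := W₁) (W₂ := W₂) A (fun _ => (1 : 𝕜))
  simp only [one_smul] at h1
  have h := mul_sum_norm_le (range m)
    (∑ n ∈ A, rotation 𝕜 (W₁.unit 𝕜) (W₂.unit 𝕜) n).1
  have hterm : ∀ k ∈ range m, ‖W₁.coeff 𝕜
      (∑ n ∈ A, rotation 𝕜 (W₁.unit 𝕜) (W₂.unit 𝕜) n).1 k‖ = (Real.sqrt 2)⁻¹ := by
    intro k hk
    have h2 : 2 * k ∈ A := Finset.mem_image_of_mem _ hk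
    have h3 : 2 * k + 1 ∉ A := by
      simp only [A, Finset.mem_image, not_exists, not_and]
      intro j _ hj
      omega
    rw [h1, if_pos h2, if_neg h3, add_zero, mul_one, norm_inv_sqrt_two]
  rw [Finset.sum_congr rfl hterm, Finset.sum_const, Finset.card_range, nsmul_eq_mul,
    mul_left_comm] at h
  have hm' : (0 : ℝ) < m := by exact_mod_cast hm
  have := le_of_mul_le_mul_left h hm'
  refine le_trans ?_ this
  rw [mul_comm]
  exact mul_le_mul_of_nonneg_left half_le_inv_sqrt_two (σ m).coe_nonneg

theorem fundamentalFunction_rotationDual_le (hσ : QuasiConcave σ) {m : ℕ} (hm : 1 ≤ m) :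
    fundamentalFunction (rotationDual (W₁.coord 𝕜) (W₂.coord 𝕜)) m ≤ 4 * (m / σ m) := by
  have : Nonempty {A : Finset ℕ // A.card ≤ m} := ⟨⟨∅, by simp⟩⟩
  have hσm : (0 : ℝ) < σ m := by exact_mod_cast hσ.pos m hm
  refine ciSup_le fun ⟨A, hA⟩ => ContinuousLinearMap.opNorm_le_bound _ (by positivity) fun f => ?_
  let D := A.image (· / 2)
  let c : ℕ → ℝ := fun k => ‖W₁.coeff 𝕜 f.1 k‖ + ‖W₂.coeff 𝕜 f.2 k‖
  have h1 : ‖(∑ n ∈ A, rotationDual (W₁.coord 𝕜) (W₂.coord 𝕜) n) f‖ ≤ ∑ n ∈ A, c (n / 2) := by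
    rw [sum_apply]
    refine norm_sum_le_of_le _ fun n _ => ?_
    rw [rotationDual_apply, norm_mul, norm_inv_sqrt_two]
    refine (mul_le_of_le_one_left (norm_nonneg _) inv_sqrt_two_le_one).trans
      ((norm_add_le _ _).trans ?_)
    simp [c]
  have h2 := sum_div_two_le A (c := c) fun k => by positivity
  have h3 : ∑ k ∈ D, c k ≤ m / σ m * (2 * ‖f‖) := by
    rcases D.eq_empty_or_nonempty with hD | hD
    · rw [hD, Finset.sum_empty]
      positivity
    have hDm : D.card ≤ m := Finset.card_image_le.trans hA
    have hσD : (0 : ℝ) < σ D.card := by exact_mod_cast hσ.pos _ hD.card_pos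
    have hratio : (D.card : ℝ) / σ D.card ≤ m / σ m := by
      rw [div_le_div_iff₀ hσD hσm]
      exact_mod_cast hσ.ratio _ _ hDm
    have hsum : (σ D.card : ℝ) * ∑ k ∈ D, c k ≤ D.card * (2 * ‖f‖) := by
      rw [Finset.sum_add_distrib, mul_add, two_mul, mul_add]
      refine add_le_add ((mul_sum_norm_le D f.1).trans ?_) ((mul_sum_norm_le D f.2).trans ?_)
      · gcongr; exact norm_fst_le f
      · gcongr; exact norm_snd_le f
    calc ∑ k ∈ D, c k = (σ D.card * ∑ k ∈ D, c k) / σ D.card := by field_simp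
      _ ≤ D.card * (2 * ‖f‖) / σ D.card := by gcongr
      _ = D.card / σ D.card * (2 * ‖f‖) := by ring
      _ ≤ _ := by gcongr
  calc _ ≤ 2 * ∑ k ∈ D, c k := h1.trans h2
    _ ≤ 2 * (m / σ m * (2 * ‖f‖)) := by gcongr
    _ = _ := by ring

theorem bidemocratic_rotation (hσ : QuasiConcave σ) :
    Bidemocratic (rotation 𝕜 (W₁.unit 𝕜) (W₂.unit 𝕜))
      (rotationDual (W₁.coord 𝕜) (W₂.coord 𝕜)) := by
  refine ⟨8, fun m hm => ?_⟩
  have hσm : (0 : ℝ) < σ m := by exact_mod_cast hσ.pos m hm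
  calc _ ≤ (2 * σ m : ℝ) * (4 * (m / σ m)) :=
        mul_le_mul (fundamentalFunction_rotation_le hσ.mono m)
          (fundamentalFunction_rotationDual_le hσ hm)
          (Real.iSup_nonneg fun _ => norm_nonneg _) (by positivity)
    _ = 8 * m := by field_simp; norm_num

/-- A greedy set `A` splits only pairs `{2k, 2k + 1}` for which one of `|g_k + h_k|`, `|g_k - h_k|`
is at least the smallest selected coefficient `α` and the other at most `α`. Then `|g_k|` and
`|h_k|` differ by at most `α`, so that over the set `D` of the split pairs either sequence is
controlled by the other one plus `α 1_D`; and the norm `α σ(|D|)` of the last term is controlled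
since `α ≤ |g_k| + |h_k|` on `D`. -/
theorem quasiGreedy_rotation (hσ : QuasiConcave σ) :
    QuasiGreedy (rotation 𝕜 (W₁.unit 𝕜) (W₂.unit 𝕜))
      (rotationDual (W₁.coord 𝕜) (W₂.coord 𝕜)) := by
  refine ⟨2, fun f A hA => ?_⟩
  rcases A.eq_empty_or_nonempty with rfl | hne
  · simp [coordProj]
  let g := W₁.coeff 𝕜 f.1
  let h := W₂.coeff 𝕜 f.2
  let u : ℕ → 𝕜 := fun n => g (n / 2) + (-1) ^ n * h (n / 2)
  have hz : ∀ n, rotationDual (W₁.coord 𝕜) (W₂.coord 𝕜) n f =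
      ((Real.sqrt 2 : ℝ) : 𝕜)⁻¹ * u n := fun n => rotationDual_apply _ _ n f
  have hu0 : ∀ k, u (2 * k) = g k + h k := fun k => by
    simp [u, pow_mul]
  have hu1 : ∀ k, u (2 * k + 1) = g k - h k := fun k => by
    simp [u, pow_succ, pow_mul, show (2 * k + 1) / 2 = k by omega, sub_eq_add_neg]
  have hgreedy : ∀ n ∈ A, ∀ k ∉ A, ‖u k‖ ≤ ‖u n‖ := fun n hn k hk => by
    have := hA n hn k hk
    rw [hz, hz, norm_mul, norm_mul, norm_inv_sqrt_two] at this
    exact le_of_mul_le_mul_left this (by positivity)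
  obtain ⟨n₀, hn₀, hmin⟩ := A.exists_min_image (fun n => ‖u n‖) hne
  let α := ‖u n₀‖
  have hout : ∀ k ∉ A, ‖u k‖ ≤ α := hgreedy n₀ hn₀
  let D := (A.image (· / 2)).filter fun k => ¬(2 * k ∈ A ↔ 2 * k + 1 ∈ A)
  have hD : ∀ k, k ∈ D ↔ ¬(2 * k ∈ A ↔ 2 * k + 1 ∈ A) := by
    intro k
    simp only [D, Finset.mem_filter, Finset.mem_image, and_iff_right_iff_imp]
    intro hk
    by_cases h0 : 2 * k ∈ A
    · exact ⟨_, h0, by omega⟩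
    · exact ⟨2 * k + 1, by tauto, by omega⟩
  have hαD : α * σ D.card ≤ 2 * ‖f‖ := by
    rcases D.eq_empty_or_nonempty with hDe | hDne
    · simp [hDe, hσ.zero]
    have hle : ∀ k ∈ D, α ≤ ‖g k‖ + ‖h k‖ := by
      intro k hk
      rw [hD] at hk
      by_cases h0 : 2 * k ∈ A
      · exact (hmin _ h0).trans (by rw [hu0]; exact norm_add_le _ _)
      · have h1 : 2 * k + 1 ∈ A := by tauto
        exact (hmin _ h1).trans (by rw [hu1]; exact norm_sub_le _ _)
    have hsum : D.card * α ≤ ∑ k ∈ D, ‖g k‖ + ∑ k ∈ D, ‖h k‖ := by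
      rw [← Finset.sum_add_distrib, ← nsmul_eq_mul]
      exact Finset.card_nsmul_le_sum _ _ _ hle
    have hc : (0 : ℝ) < D.card := by exact_mod_cast hDne.card_pos
    refine le_of_mul_le_mul_left ?_ hc
    calc (D.card : ℝ) * (α * σ D.card) = σ D.card * (D.card * α) := by ring
      _ ≤ σ D.card * (∑ k ∈ D, ‖g k‖ + ∑ k ∈ D, ‖h k‖) := by gcongr
      _ = σ D.card * ∑ k ∈ D, ‖g k‖ + σ D.card * ∑ k ∈ D, ‖h k‖ := by ring
      _ ≤ D.card * ‖f.1‖ + D.card * ‖f.2‖ :=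
          add_le_add (mul_sum_norm_le D f.1) (mul_sum_norm_le D f.2)
      _ ≤ D.card * ‖f‖ + D.card * ‖f‖ := by
          gcongr
          · exact norm_fst_le f
          · exact norm_snd_le f
      _ = D.card * (2 * ‖f‖) := by ring
  have hα : 0 ≤ α / 2 := by positivity
  have htri : ∀ a b p : 𝕜, p = a + 2⁻¹ * b → ‖b‖ ≤ α → ‖p‖ ≤ ‖a‖ + α / 2 := by
    rintro a b p rfl hb
    refine (norm_add_le _ _).trans ?_
    rw [norm_mul, norm_inv, RCLike.norm_ofNat]
    linarith
  have htri' : ∀ a p : 𝕜, p = a → ‖p‖ ≤ ‖a‖ + 0 := by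
    rintro a p rfl
    simp
  have hsplit : ∀ k, (if k ∈ D then α / 2 else 0) =
      if (2 * k ∈ A ↔ 2 * k + 1 ∈ A) then 0 else α / 2 := by
    intro k
    simp only [hD]
    split_ifs <;> simp_all
  have hcoef : ∀ t : 𝕜, ((Real.sqrt 2 : ℝ) : 𝕜)⁻¹ * (((Real.sqrt 2 : ℝ) : 𝕜)⁻¹ * t) = 2⁻¹ * t :=
    fun t => by rw [← mul_assoc, inv_sqrt_two_mul_self]
  have hfst : ‖(coordProj (rotation 𝕜 (W₁.unit 𝕜) (W₂.unit 𝕜))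
      (rotationDual (W₁.coord 𝕜) (W₂.coord 𝕜)) A f).1‖ ≤ ‖f.1‖ + α / 2 * σ D.card := by
    refine norm_le_add hα fun k => ?_
    unfold coordProj
    rw [coeff_sum_rotation_fst, hz, hz, hsplit]
    by_cases h0 : 2 * k ∈ A <;> by_cases h1 : 2 * k + 1 ∈ A <;>
      simp only [h0, h1, if_true, if_false, iff_true, iff_false, not_true]
    · refine htri' _ _ ?_
      rw [← mul_add, hcoef, hu0, hu1]
      ring
    · refine htri _ (-u (2 * k + 1)) _ ?_ (by rw [norm_neg]; exact hout _ h1)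
      rw [add_zero, hcoef, hu0, hu1]
      ring
    · refine htri _ (-u (2 * k)) _ ?_ (by rw [norm_neg]; exact hout _ h0)
      rw [zero_add, hcoef, hu0, hu1]
      ring
    · simp
  have hsnd : ‖(coordProj (rotation 𝕜 (W₁.unit 𝕜) (W₂.unit 𝕜))
      (rotationDual (W₁.coord 𝕜) (W₂.coord 𝕜)) A f).2‖ ≤ ‖f.2‖ + α / 2 * σ D.card := by
    refine norm_le_add hα fun k => ?_
    unfold coordProj
    rw [coeff_sum_rotation_snd, hz, hz, hsplit]
    by_cases h0 : 2 * k ∈ A <;> by_cases h1 : 2 * k + 1 ∈ A <;>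
      simp only [h0, h1, if_true, if_false, iff_true, iff_false, not_true]
    · refine htri' _ _ ?_
      rw [← mul_sub, hcoef, hu0, hu1]
      ring
    · refine htri _ (u (2 * k + 1)) _ ?_ (hout _ h1)
      rw [sub_zero, hcoef, hu0, hu1]
      ring
    · refine htri _ (-u (2 * k)) _ ?_ (by rw [norm_neg]; exact hout _ h0)
      rw [zero_sub, mul_neg, hcoef, hu0, hu1]
      ring
    · simp
  rw [Prod.norm_def]
  refine max_le (hfst.trans ?_) (hsnd.trans ?_)
  · linarith [norm_fst_le f]
  · linarith [norm_snd_le f]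

end WeightFamily

/-! ### Conditionality -/

/-- The superposition `∑_{j < J} 1_{[0, m_j)} / p(m_j)`. -/
def staircase (p : ℕ → ℝ≥0) (m : ℕ → ℕ) (J k : ℕ) : ℝ≥0 :=
  ∑ j ∈ range J, if k < m j then (p (m j))⁻¹ else 0

section Staircase

variable {p q : ℕ → ℝ≥0} {m : ℕ → ℕ}

/-- If `p` and `q` at least double from each `m_j` to the next, the terms of the sum increase
geometrically as long as `m_j ≤ k`, and decrease geometrically from there on. -/
theorem sum_min_div_le (hp : QuasiConcave p) (hq : QuasiConcave q) (hpq : ∀ k, p k * q k = k)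
    (hm : ∀ j, 1 ≤ m j) (hpm : ∀ j, 2 * p (m j) ≤ p (m (j + 1)))
    (hqm : ∀ j, 2 * q (m j) ≤ q (m (j + 1))) (k J : ℕ) :
    ∑ j ∈ range J, (min k (m j) : ℕ) * (p (m j))⁻¹ ≤ 4 * q k := by
  rcases Nat.eq_zero_or_pos k with rfl | hk
  · simp
  have hpos : ∀ j, 0 < p (m j) := fun j => hp.pos _ (hm j)
  have hsmall : ∀ j, m j ≤ k → (min k (m j) : ℕ) * (p (m j))⁻¹ = q (m j) := fun j hj => by
    rw [min_eq_right hj, ← hpq, mul_comm (p _), mul_assoc, mul_inv_cancel₀ (hpos j).ne', mul_one]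
  have hlarge : ∀ j, k < m j → k * (p (m j))⁻¹ ≤ q k := fun j hj => by
    rw [← hpq, mul_comm (p k), mul_assoc]
    refine mul_le_of_le_one_right zero_le ?_
    rw [← div_eq_mul_inv]
    exact div_le_one_of_le₀ (hp.mono hj.le) zero_le
  have key : ∀ J, (m J ≤ k ∧ ∑ j ∈ range (J + 1), (min k (m j) : ℕ) * (p (m j))⁻¹ ≤ 2 * q (m J)) ∨
      (k < m J ∧ ∑ j ∈ range (J + 1), (min k (m j) : ℕ) * (p (m j))⁻¹ + k * (p (m J))⁻¹
        ≤ 4 * q k) := by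
    intro J
    induction J with
    | zero =>
      rcases le_or_gt (m 0) k with h | h
      · refine Or.inl ⟨h, ?_⟩
        rw [zero_add, Finset.sum_range_one, hsmall 0 h, two_mul]
        exact le_add_of_nonneg_left zero_le
      · refine Or.inr ⟨h, ?_⟩
        rw [zero_add, Finset.sum_range_one, min_eq_left h.le]
        calc _ ≤ q k + q k := add_le_add (hlarge 0 h) (hlarge 0 h)
          _ = 2 * q k := (two_mul _).symm
          _ ≤ 4 * q k := by gcongr; norm_num
    | succ J ih =>
      rw [Finset.sum_range_succ]
      rcases le_or_gt (m (J + 1)) k with h | h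
      · refine Or.inl ⟨h, ?_⟩
        rcases ih with ⟨h1, h2⟩ | ⟨h1, h2⟩
        · rw [hsmall _ h, two_mul (q (m (J + 1)))]
          gcongr
          exact h2.trans (hqm J)
        · have h3 := (hpm J).trans (hp.mono (h.trans h1.le))
          rw [two_mul] at h3
          exact absurd h3 (not_le.2 (lt_add_of_pos_left _ (hpos J)))
      · refine Or.inr ⟨h, ?_⟩
        rw [min_eq_left h.le]
        rcases ih with ⟨h1, h2⟩ | ⟨h1, h2⟩
        · calc _ ≤ 2 * q k + q k + q k := by
                refine add_le_add (add_le_add (h2.trans ?_) (hlarge _ h)) (hlarge _ h)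
                exact mul_le_mul_right (hq.mono h1) _
            _ = 4 * q k := by ring
        · refine le_trans ?_ h2
          rw [add_assoc]
          gcongr
          rw [← mul_add, ← two_mul]
          gcongr
          rw [← div_eq_mul_inv, div_le_iff₀ (hpos _), inv_mul_eq_div, le_div_iff₀ (hpos _)]
          exact hpm J
  cases J with
  | zero => simp
  | succ J =>
    rcases key J with ⟨h1, h2⟩ | ⟨-, h2⟩
    · refine h2.trans ?_
      gcongr
      · norm_num
      · exact hq.mono h1
    · exact (le_add_of_nonneg_right zero_le).trans h2

theorem sum_staircase_le (hp : QuasiConcave p) (hq : QuasiConcave q) (hpq : ∀ k, p k * q k = k)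
    (hm : ∀ j, 1 ≤ m j) (hpm : ∀ j, 2 * p (m j) ≤ p (m (j + 1)))
    (hqm : ∀ j, 2 * q (m j) ≤ q (m (j + 1))) (J : ℕ) (A : Finset ℕ) :
    ∑ k ∈ A, staircase p m J k ≤ 4 * q A.card := by
  refine le_trans ?_ (sum_min_div_le hp hq hpq hm hpm hqm A.card J)
  unfold staircase
  rw [Finset.sum_comm]
  refine Finset.sum_le_sum fun j _ => ?_
  rw [← Finset.sum_filter, Finset.sum_const, nsmul_eq_mul]
  gcongr
  refine le_min (Finset.card_filter_le _ _) ?_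
  refine (Finset.card_le_card (t := range (m j)) fun k hk => ?_).trans_eq (Finset.card_range _)
  exact Finset.mem_range.2 (Finset.mem_filter.1 hk).2

/-- The diagonal terms of the product already add up to `J`. -/
theorem le_sum_staircase_mul (hpq : ∀ k, p k * q k = k) (hm : ∀ j, 1 ≤ m j) (J : ℕ) {M : ℕ}
    (hM : ∀ j < J, m j ≤ M) :
    (J : ℝ≥0) ≤ ∑ k ∈ range M, staircase p m J k * staircase q m J k := by
  calc (J : ℝ≥0) = ∑ j ∈ range J, ∑ k ∈ range M, if k < m j then (p (m j) * q (m j))⁻¹ else 0 := by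
        rw [Finset.sum_congr rfl (g := fun _ => (1 : ℝ≥0))]
        · simp
        intro j hj
        have hfil : (range M).filter (· < m j) = range (m j) := by
          ext k
          have := hM j (Finset.mem_range.1 hj)
          simp only [Finset.mem_filter, Finset.mem_range]
          omega
        have h0 : (m j : ℝ≥0) ≠ 0 := by
          have := hm j
          exact_mod_cast (by omega : m j ≠ 0)
        rw [← Finset.sum_filter, hfil, Finset.sum_const, Finset.card_range, nsmul_eq_mul, hpq,
          mul_inv_cancel₀ h0]
    _ = ∑ k ∈ range M, ∑ j ∈ range J, (if k < m j then (p (m j))⁻¹ else 0) *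
          if k < m j then (q (m j))⁻¹ else 0 := by
        rw [Finset.sum_comm]
        refine Finset.sum_congr rfl fun k _ => Finset.sum_congr rfl fun j _ => ?_
        split_ifs
        · rw [mul_inv]
        · rw [mul_zero]
    _ ≤ _ := by
        refine Finset.sum_le_sum fun k _ => ?_
        unfold staircase
        rw [Finset.sum_mul]
        refine Finset.sum_le_sum fun j hj => ?_
        gcongr
        exact Finset.single_le_sum (f := fun j => if k < m j then (q (m j))⁻¹ else 0)
          (fun _ _ => zero_le) hj

end Staircase

theorem QuasiConcave.dual {σ : ℕ → ℝ≥0} (hσ : QuasiConcave σ) :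
    QuasiConcave fun m => m / σ m where
  zero := by simp
  pos m hm := div_pos (by exact_mod_cast hm) (hσ.pos m hm)
  mono := by
    intro m n hmn
    rcases Nat.eq_zero_or_pos m with rfl | hm
    · simp
    · rw [div_le_div_iff₀ (hσ.pos m hm) (hσ.pos n (hm.trans_le hmn))]
      exact hσ.ratio m n hmn
  ratio m n hmn := by
    rcases Nat.eq_zero_or_pos m with rfl | hm
    · simp
    · rw [mul_div_left_comm]
      have := hσ.mono hmn
      have := hσ.pos m hm
      gcongr

theorem QuasiConcave.mul_dual {σ : ℕ → ℝ≥0} (hσ : QuasiConcave σ) (k : ℕ) :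
    σ k * (k / σ k) = k := by
  rcases Nat.eq_zero_or_pos k with rfl | hk
  · simp
  · exact mul_div_cancel₀ _ (hσ.pos k hk).ne'

theorem exists_lacunary {p q : ℕ → ℝ≥0} (hp : QuasiConcave p) (hq : QuasiConcave q)
    (hp' : ∀ B, ∃ m, B ≤ p m) (hq' : ∀ B, ∃ m, B ≤ q m) :
    ∃ m : ℕ → ℕ, (∀ j, 1 ≤ m j) ∧ (∀ j, 2 * p (m j) ≤ p (m (j + 1))) ∧
      ∀ j, 2 * q (m j) ≤ q (m (j + 1)) := by
  choose a ha using hp'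
  choose b hb using hq'
  let F : ℕ → ℕ := fun n => max 1 (max (a (2 * p n)) (b (2 * q n)))
  have hF : ∀ j, F^[j + 1] 1 = F (F^[j] 1) := fun j => Function.iterate_succ_apply' F j 1
  refine ⟨fun j => F^[j] 1, fun j => ?_, fun j => ?_, fun j => ?_⟩
  · cases j with
    | zero => exact le_rfl
    | succ j => exact (le_max_left _ _).trans_eq (hF j).symm
  · simp only [hF]
    exact (ha _).trans (hp.mono ((le_max_left _ _).trans (le_max_right _ _)))
  · simp only [hF]
    exact (hb _).trans (hq.mono ((le_max_right _ _).trans (le_max_right _ _)))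

variable {𝕜 : Type*} [RCLike 𝕜] {σ : ℕ → ℝ≥0}

/-- The staircase sequences are bounded in the Marcinkiewicz space and unbounded in the Lorentz
space, while the projection of `(0, h)` to the span of the `z_{2k}` is `(h, h) / 2`. -/
theorem conditional_rotation (hσ : QuasiConcave σ) (hσ' : ∀ B, ∃ m, B ≤ σ m)
    (hτ' : ∀ B, ∃ m : ℕ, B ≤ m / σ m) :
    Conditional (rotation 𝕜 ((maximalFamily hσ).unit 𝕜) ((minimalFamily hσ).unit 𝕜))
      (rotationDual ((maximalFamily hσ).coord 𝕜) ((minimalFamily hσ).coord 𝕜)) := by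
  rintro ⟨C, hC⟩
  obtain ⟨m, hm, hσm, hτm⟩ := exists_lacunary hσ hσ.dual hσ' hτ'
  -- The projection has norm at least `J / 8` by `hX`, and at most `4 |C|` by `hY`.
  obtain ⟨J, hJ⟩ := exists_nat_gt (32 * |C|)
  obtain ⟨M, hM⟩ : ∃ M, ∀ j < J, m j ≤ M :=
    ⟨∑ j ∈ range J, m j, fun j hj =>
      Finset.single_le_sum (fun _ _ => Nat.zero_le _) (Finset.mem_range.2 hj)⟩
  let h : ℕ → 𝕜 := fun k => ((staircase σ m J k : ℝ) : 𝕜)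
  let g : ℕ → ℝ≥0 := fun k => staircase (fun k => k / σ k) m J k / 4
  have hh : ∀ k, ‖h k‖ₑ = staircase σ m J k := fun k => by
    simp [h, enorm_eq_nnnorm]
  have hzero : ∀ k, M ≤ k → h k = 0 := by
    intro k hk
    have : staircase σ m J k = 0 := Finset.sum_eq_zero fun j hj =>
      if_neg (not_lt.2 ((hM j (Finset.mem_range.1 hj)).trans hk))
    simp [h, this]
  have hfin : h.support.Finite := (Set.finite_lt_nat M).subset fun k hk => by
    by_contra hle
    exact hk (hzero k (not_lt.1 hle))
  have hY : (minimalFamily hσ).gauge h ≤ (4 : ℝ≥0) := by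
    refine WeightFamily.gauge_le ?_
    rintro _ ⟨D, rfl⟩
    rw [tsum_eq_sum (s := D) (fun n hn => by simp [uniformWeight, hn])]
    simp only [hh, ← ENNReal.coe_mul, ← ENNReal.ofNNReal_finsetSum, ENNReal.coe_le_coe]
    rcases D.eq_empty_or_nonempty with rfl | hD
    · simp
    have h1 : (0 : ℝ≥0) < D.card := by exact_mod_cast hD.card_pos
    have h2 := hσ.pos _ hD.card_pos
    calc ∑ n ∈ D, uniformWeight σ D n * staircase σ m J n
        = σ D.card / D.card * ∑ n ∈ D, staircase σ m J n := by
          rw [Finset.mul_sum]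
          refine Finset.sum_congr rfl fun n hn => ?_
          simp only [uniformWeight, Set.indicator_of_mem (Finset.mem_coe.2 hn)]
      _ ≤ σ D.card / D.card * (4 * (D.card / σ D.card)) := by
          have := sum_staircase_le hσ hσ.dual hσ.mul_dual hm hσm hτm J D
          exact mul_le_mul_right this _
      _ = 4 := by field_simp
  have hX : ((J / 4 : ℝ≥0) : ℝ≥0∞) ≤ (maximalFamily hσ).gauge h := by
    have hg : g ∈ (maximalFamily hσ).carrier := by
      intro D
      have := sum_staircase_le hσ.dual hσ (fun k => by rw [mul_comm]; exact hσ.mul_dual k) hm hτm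
        hσm J D
      rw [← Finset.sum_div]
      exact div_le_of_le_mul₀ zero_le zero_le (by rwa [mul_comm])
    refine le_trans ?_ (WeightFamily.le_gauge hg h)
    refine le_trans ?_ (ENNReal.sum_le_tsum (range M))
    simp only [hh, ← ENNReal.coe_mul, ← ENNReal.ofNNReal_finsetSum, ENNReal.coe_le_coe]
    have := le_sum_staircase_mul hσ.mul_dual hm J hM
    calc (J / 4 : ℝ≥0) ≤ (∑ k ∈ range M, staircase σ m J k *
          staircase (fun k => k / σ k) m J k) / 4 := div_le_div_of_nonneg_right this zero_le
      _ = _ := by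
          rw [Finset.sum_div]
          exact Finset.sum_congr rfl fun k _ => by simp only [g]; ring
  let f : (maximalFamily hσ).Space 𝕜 × (minimalFamily hσ).Space 𝕜 :=
    (0, (minimalFamily hσ).ofFinite 𝕜 h hfin)
  have hf : ‖f‖ ≤ 4 := by
    rw [Prod.norm_def, norm_zero, max_eq_right (norm_nonneg _), WeightFamily.norm_def]
    exact ENNReal.toReal_mono (by simp) hY
  let A := (range M).image (2 * ·)
  have hcoeff : (maximalFamily hσ).coeff 𝕜 (coordProj
      (rotation 𝕜 ((maximalFamily hσ).unit 𝕜) ((minimalFamily hσ).unit 𝕜))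
      (rotationDual ((maximalFamily hσ).coord 𝕜) ((minimalFamily hσ).coord 𝕜)) A f).1 =
        (2⁻¹ : 𝕜) • h := by
    funext k
    have h1 : 2 * k + 1 ∉ A := by
      simp only [A, Finset.mem_image, not_exists, not_and]
      intro j _ hj
      omega
    have h0 : 2 * k ∈ A ↔ k < M := by
      simp [A]
    unfold coordProj
    rw [WeightFamily.coeff_sum_rotation_fst, if_neg h1, add_zero, rotationDual_apply,
      show 2 * k / 2 = k by omega, pow_mul, neg_one_sq, one_pow, one_mul, Pi.smul_apply]
    simp only [h0, f, map_zero, zero_add, WeightFamily.coord_apply, WeightFamily.coeff_ofFinite]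
    split_ifs with hk
    · rw [← mul_assoc, inv_sqrt_two_mul_self, smul_eq_mul]
    · rw [hzero k (not_lt.1 hk), mul_zero, smul_zero]
  have hproj := (norm_fst_le _).trans (hC f A)
  rw [WeightFamily.norm_def, hcoeff, WeightFamily.gauge_smul, ENNReal.toReal_mul, toReal_enorm,
    norm_inv, RCLike.norm_ofNat] at hproj
  have hX' := ENNReal.toReal_mono (WeightFamily.gauge_lt_top_of_finite hfin).ne hX
  rw [ENNReal.coe_toReal] at hX'
  push_cast at hX'
  have hbound : C * ‖f‖ ≤ |C| * 4 :=
    mul_le_mul (le_abs_self C) hf (norm_nonneg _) (abs_nonneg C)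
  linarith

end GreedyBasis

end

open GreedyBasis
open scoped NNReal

theorem mainTheorem8 {𝕜 : Type u} [RCLike 𝕜] (s : ℕ → ℝ)
    (hs_pos : ∀ m : ℕ, 1 ≤ m → 0 < s m)
    (hs_mono : MonotoneOn s (Set.Ici 1))
    (hs_unbounded : ¬ BddAbove (s '' Set.Ici 1))
    (hq_mono : MonotoneOn (fun m : ℕ => (m : ℝ) / s m) (Set.Ici 1))
    (hq_unbounded : ¬ BddAbove ((fun m : ℕ => (m : ℝ) / s m) '' Set.Ici 1)) :
    ∃ (X : Type u) (_ : NormedAddCommGroup X) (_ : NormedSpace 𝕜 X) (_ : CompleteSpace X)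
      (Y : Type u) (_ : NormedAddCommGroup Y) (_ : NormedSpace 𝕜 Y) (_ : CompleteSpace Y)
      (J : X →ₗ[𝕜] (ℕ → 𝕜)) (K : Y →ₗ[𝕜] (ℕ → 𝕜))
      (x : ℕ → X) (x' : ℕ → StrongDual 𝕜 X) (y : ℕ → Y) (y' : ℕ → StrongDual 𝕜 Y)
      (z' : ℕ → StrongDual 𝕜 (X × Y)),
      -- `X` is `d_{1,1}(w)`, `Y` is `m_0(w*)`, and `x`, `y` are their unit vector bases
      GreedyBasis.IsLorentzSpace (GreedyBasis.weightOf s) J ∧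
      GreedyBasis.IsMarcinkiewiczZeroSpace
        (GreedyBasis.weightOf (fun m : ℕ => (m : ℝ) / s m)) K ∧
      (∀ n, J (x n) = Pi.single n 1) ∧ (∀ n, K (y n) = Pi.single n 1) ∧
      GreedyBasis.IsBasis x x' ∧ GreedyBasis.IsBasis y y' ∧
      -- the rotated sequence is a basis of the Banach space `X × Y` with the stated properties
      GreedyBasis.IsBasis (GreedyBasis.rotation 𝕜 x y) z' ∧
      GreedyBasis.Conditional (GreedyBasis.rotation 𝕜 x y) z' ∧
      GreedyBasis.Bidemocratic (GreedyBasis.rotation 𝕜 x y) z' ∧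
      GreedyBasis.QuasiGreedy (GreedyBasis.rotation 𝕜 x y) z' ∧
      GreedyBasis.Equivalent
        (GreedyBasis.fundamentalFunction (GreedyBasis.rotation 𝕜 x y)) s := by
  -- The unused value `s 0` is replaced by `0`.
  let σ : ℕ → ℝ≥0 := fun m => if m = 0 then 0 else (s m).toNNReal
  have hσs : ∀ m, 1 ≤ m → (σ m : ℝ) = s m := fun m hm => by
    simp only [σ, if_neg (show m ≠ 0 by omega)]
    exact Real.coe_toNNReal _ (hs_pos m hm).le
  have hσ : QuasiConcave σ := by
    refine ⟨if_pos rfl, fun m hm => ?_, fun m n hmn => ?_, fun m n hmn => ?_⟩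
    · rw [← NNReal.coe_pos, hσs m hm]
      exact hs_pos m hm
    · rcases Nat.eq_zero_or_pos m with rfl | hm
      · simp [σ]
      · rw [← NNReal.coe_le_coe, hσs m hm, hσs n (hm.trans_le hmn)]
        exact hs_mono hm (hm.trans_le hmn) hmn
    · rcases Nat.eq_zero_or_pos m with rfl | hm
      · simp
      · rw [← NNReal.coe_le_coe]
        push_cast
        rw [hσs m hm, hσs n (hm.trans_le hmn), ← div_le_div_iff₀ (hs_pos m hm)
          (hs_pos n (hm.trans_le hmn))]
        exact hq_mono hm (hm.trans_le hmn) hmn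
  have hσ' : ∀ B, ∃ m, B ≤ σ m := by
    intro B
    by_contra! hB
    refine hs_unbounded ⟨B, ?_⟩
    rintro _ ⟨m, hm, rfl⟩
    rw [← hσs m hm]
    exact_mod_cast (hB m).le
  have hτ' : ∀ B, ∃ m : ℕ, B ≤ m / σ m := by
    intro B
    by_contra! hB
    refine hq_unbounded ⟨B, ?_⟩
    rintro _ ⟨m, hm, rfl⟩
    dsimp only
    rw [← hσs m hm]
    exact_mod_cast (hB m).le
  have hw : ∀ m, ∑ n ∈ Finset.range m, (weightOf s n).toNNReal = σ m := by
    have hnonneg : ∀ n, 0 ≤ weightOf s n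
      | 0 => (hs_pos 1 le_rfl).le
      | n + 1 => sub_nonneg.2 (hs_mono (Set.mem_Ici.2 (by omega)) (Set.mem_Ici.2 (by omega))
          (Nat.le_succ _))
    rintro (_ | m)
    · simp [σ]
    · rw [← NNReal.coe_inj, NNReal.coe_sum, hσs _ (by omega), ← sum_weightOf s m]
      exact Finset.sum_congr rfl fun n _ => Real.coe_toNNReal _ (hnonneg n)
  have hw' : ∀ m, ∑ n ∈ Finset.range (m + 1), weightOf (fun m : ℕ => (m : ℝ) / s m) n =
      ((m + 1 : ℕ) / σ (m + 1) : ℝ≥0) := by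
    intro m
    rw [sum_weightOf, NNReal.coe_div, hσs _ (by omega), NNReal.coe_natCast]
  let W₁ := maximalFamily hσ
  let W₂ := minimalFamily hσ
  refine ⟨W₁.Space 𝕜, inferInstance, inferInstance, inferInstance,
    W₂.Space 𝕜, inferInstance, inferInstance, inferInstance,
    W₁.coeff 𝕜, W₂.coeff 𝕜, W₁.unit 𝕜, W₁.coord 𝕜, W₂.unit 𝕜, W₂.coord 𝕜,
    rotationDual (W₁.coord 𝕜) (W₂.coord 𝕜),
    isLorentzSpace hσ hw, isMarcinkiewiczZeroSpace hσ hw', fun _ => rfl, fun _ => rfl,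
    W₁.isBasis, W₂.isBasis, W₁.isBasis.rotation W₂.isBasis, conditional_rotation hσ hσ' hτ',
    WeightFamily.bidemocratic_rotation hσ, WeightFamily.quasiGreedy_rotation hσ,
    1 / 2, 2, by norm_num, two_pos, fun m hm => ?_⟩
  rw [← hσs m hm]
  exact ⟨WeightFamily.le_fundamentalFunction_rotation hσ.mono hm,
    WeightFamily.fundamentalFunction_rotation_le hσ.mono m⟩
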